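/- **Setting.** Let $g:\mathbb{R}^d\to\mathbb{R}^d$ and $h(x)=x-g(x)$. Assume that $h(x^*)=0$, that $h$ is Lipschitz continuously differentiable in a neighbourhood of $x^*$, that $h'(x^*)$ is positive definite ($y^{\mathrm T}h'(x^*)y>0$ for $y\ne 0$), and that $g'(x)$ is symmetric for all $x$ near $x^*$. Let $\hat\rho,\hat\kappa,\mu,L>0$ be constants such that for all $x$ with $\|x-x^*\|_2\le\hat\rho$ and all $y\in\mathbb{R}^d$ $$\mu\|y\|_2\le\|h'(x)y\|_2\le L\|y\|_2,\qquad \mu\|y\|_2^2\le y^{\mathrm T}h'(x)y\le L\|y\|_2^2,\qquad \|h(x)-h'(x^*)(x-x^*)\|_2\le\tfrac12\hat\kappa\|x-x^*\|_2^2 .$$ Put $A=I-g'(x^*)$ and $\|y\|_A=(y^{\mathrm T}Ay)^{1/2}$. **Restarted ST-AM.** Fix an integer $m$ with $0<m\le d$, and $\tau\in(0,1)$, $\eta>0$. Given $x_0$ and mixing parameters $\beta_k$, set $m_0=0$, and for $k=0,1,\dots$ do the following, with $v_j=p_j$ (Type-I) or $v_j=q_j$ (Type-II) throughout. 1. Set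 $r_k=g(x_k)-x_k$. If $m_k>m$ or $\|r_k\|_2>\eta\|r_{k-m_k}\|_2$, reset $m_k=0$. 2. If $m_k>0$: start with $p_k=x_k-x_{k-1}$, $q_k=r_k-r_{k-1}$. For $j=\max\{1,m_k-2\},\dots,m_k-1$ in this order, put $i=k-m_k+j$ and $\zeta=v_i^{\mathrm T}q_k/v_i^{\mathrm T}q_i$, and replace $p_k$ by $p_k-\zeta p_i$ and $q_k$ by $q_k-\zeta q_i$. Then, if $|v_k^{\mathrm T}q_k|<\tau|v_{k-m_k+1}^{\mathrm T}q_{k-m_k+1}|$, reset $m_k=0$. 3. Start with $\bar x_k=x_k$, $\bar r_k=r_k$. For $j=\max\{1,m_k-1\},\dots,m_k$ in this order (no $j$ if $m_k=0$), put $i=k-m_k+j$ and $\gamma=v_i^{\mathrm T}\bar r_k/v_i^{\mathrm T}q_i$, and replace $\bar x_k$ by $\bar x_k-\gamma p_i$ and $\bar r_k$ by $\bar r_k-\gamma q_i$. 4. Set $x_{k+1}=\bar x_k+\beta_k\bar r_k$ and $m_{k+1}=m_k+1$. Once $r_k=0$, all later iterates equal $x_k$ (read $0/0$ as $0$). Below,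 $m_k$ is its value in steps 3 and 4, after the resets in iteration $k$. **Theorem.** Let $\theta\in\bigl[\frac{L-\mu}{L+\mu},1\bigr)$. There is a constant $C>0$, depending only on $d,m,\tau,\eta,\mu,L,\theta$, such that for all $g,x^*,\hat\rho,\hat\kappa$ as above there is $\delta>0$ for which the following holds. If $\|x_0-x^*\|_2\le\delta$ and $\theta_k:=\|I-\beta_kA\|_2\le\theta$ for all $k$, then for all $k\ge 0$: 1. for the Type-I method, $$\|x_{k+1}-x^*\|_A\le 2\theta_k\left(\frac{\sqrt{L/\mu}-1}{\sqrt{L/\mu}+1}\right)^{m_k}\|x_{k-m_k}-x^*\|_A+\hat\kappa\, C\,\|x_{k-m_k}-x^*\|_2^2;$$ 2. for the Type-II method, $$\|r_{k+1}\|_2\le 2\theta_k\left(\frac{\sqrt{L/\mu}-1}{\sqrt{L/\mu}+1}\right)^{m_k}\|r_{k-m_k}\|_2+\hat\kappa\, C\,\|x_{k-m_k}-x^*\|_2^2;$$ 3. for either method, if $m_k=d$, then $\|x_{k+1}-x^*\|_2\le\hat\kappa\, C\,\|x_{k-m_k}-x^*\|_2^2$ ($(d+1)$-step quadratic convergence).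 -/

import Mathlib

open scoped RealInnerProductSpace Topology NNReal

noncomputable section

/-- The two variants of Anderson mixing: Type-I uses `v_j = p_j`, Type-II uses `v_j = q_j`. -/
inductive AMType where
  | typeI
  | typeII

namespace STAM

/-- `ℝ^d` with the Euclidean norm and inner product. -/
abbrev Vec (d : ℕ) : Type := EuclideanSpace ℝ (Fin d)

/-- The residual `r = g(x) - x` at the point `x`. -/
def residual {d : ℕ} (g : Vec d → Vec d) (x : Vec d) : Vec d := g x - x

/-- The vectors `v_j`: `v_j = p_j` for Type-I and `v_j = q_j` for Type-II. -/
def dir {d : ℕ} : AMType → (ℕ → Vec d) → (ℕ → Vec d) → ℕ → Vec d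
  | .typeI, p, _ => p
  | .typeII, _, q => q

/-- One pass of a projection loop: for each index `i` of the list, in order, compute
`γ = (v_i ⬝ b) / (v_i ⬝ q_i)` with the current `b` and replace the pair `(a, b)` by
`(a - γ p_i, b - γ q_i)`. -/
def sweep {d : ℕ} (v p q : ℕ → Vec d) (idx : List ℕ) (ab : Vec d × Vec d) : Vec d × Vec d :=
  idx.foldl (fun c i => (c.1 - (⟪v i, c.2⟫ / ⟪v i, q i⟫) • p i,
    c.2 - (⟪v i, c.2⟫ / ⟪v i, q i⟫) • q i)) ab

/-- The data produced by the algorithm so far. When iteration `k` begins, the entries `x i` and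
`m i` with `i ≤ k` and `p i`, `q i` with `i < k` are the meaningful ones, and `m k` is the
tentative value of `m_k`, which the restart tests of iteration `k` may reset to zero. -/
structure History (d : ℕ) where
  x : ℕ → Vec d
  p : ℕ → Vec d
  q : ℕ → Vec d
  m : ℕ → ℕ

/-- The history before iteration `0`: the initial point `x₀` and `m₀ = 0`. -/
def init {d : ℕ} (x₀ : Vec d) : History d where
  x := fun _ => x₀
  p := fun _ => 0
  q := fun _ => 0
  m := fun _ => 0

/-- Iteration `k` of restarted ST-AM, with memory bound `mmax` and parameters `τ`, `η`, `β`. -/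
def step {d : ℕ} (ty : AMType) (g : Vec d → Vec d) (mmax : ℕ) (τ η : ℝ) (β : ℕ → ℝ)
    (k : ℕ) (s : History d) : History d :=
  let r : ℕ → Vec d := fun i => residual g (s.x i)
  -- first restart test
  let m₁ : ℕ := open Classical in
    if mmax < s.m k ∨ η * ‖r (k - s.m k)‖ < ‖r k‖ then 0 else s.m k
  -- the modified vector pair, for `j = max {1, m₁ - 2}, …, m₁ - 1`
  let pq : Vec d × Vec d :=
    sweep (dir ty s.p s.q) s.p s.q
      ((List.Ico (max 1 (m₁ - 2)) m₁).map (fun j => k - m₁ + j))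
      (s.x k - s.x (k - 1), r k - r (k - 1))
  let p : ℕ → Vec d := if 0 < m₁ then Function.update s.p k pq.1 else s.p
  let q : ℕ → Vec d := if 0 < m₁ then Function.update s.q k pq.2 else s.q
  let v : ℕ → Vec d := dir ty p q
  -- second restart test
  let m₂ : ℕ := open Classical in
    if 0 < m₁ ∧ |⟪v k, q k⟫| < τ * |⟪v (k - m₁ + 1), q (k - m₁ + 1)⟫| then 0 else m₁
  -- the pair of `x̄_k` and `r̄_k`, for `j = max {1, m₂ - 1}, …, m₂`
  let xr : Vec d × Vec d :=
    sweep v p q ((List.Ico (max 1 (m₂ - 1)) (m₂ + 1)).map (fun j => k - m₂ + j)) (s.x k, r k)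
  { x := Function.update s.x (k + 1) (xr.1 + β k • xr.2)
    p := p
    q := q
    m := Function.update (Function.update s.m k m₂) (k + 1) (m₂ + 1) }

/-- The history after the iterations `0, …, k - 1`. The loop is not stopped at convergence: once
`r_k = 0`, all further iterates equal `x_k` (with `0 / 0 = 0`). -/
def run {d : ℕ} (ty : AMType) (g : Vec d → Vec d) (mmax : ℕ) (τ η : ℝ) (β : ℕ → ℝ)
    (x₀ : Vec d) : ℕ → History d
  | 0 => init x₀
  | k + 1 => step ty g mmax τ η β k (run ty g mmax τ η β x₀ k)

/-- The iterate `x_k` of restarted ST-AM. -/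
def iterate {d : ℕ} (ty : AMType) (g : Vec d → Vec d) (mmax : ℕ) (τ η : ℝ) (β : ℕ → ℝ)
    (x₀ : Vec d) (k : ℕ) : Vec d :=
  (run ty g mmax τ η β x₀ k).x k

/-- The value of `m_k` used in the update of iteration `k`, that is, after both restart tests. -/
def memory {d : ℕ} (ty : AMType) (g : Vec d → Vec d) (mmax : ℕ) (τ η : ℝ) (β : ℕ → ℝ)
    (x₀ : Vec d) (k : ℕ) : ℕ :=
  (run ty g mmax τ η β x₀ (k + 1)).m k

/-- `h` vanishes at `xs`, is Lipschitz continuously differentiable in a neighbourhood of `xs`, and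
its Jacobian at `xs` is positive definite. -/
structure RegularZero {d : ℕ} (h : Vec d → Vec d) (xs : Vec d) : Prop where
  zero : h xs = 0
  lipschitz_deriv : ∃ U ∈ 𝓝 xs, (∀ x ∈ U, DifferentiableAt ℝ h x) ∧
    ∃ K : ℝ≥0, LipschitzOnWith K (fderiv ℝ h) U
  posDef : ∀ y : Vec d, y ≠ 0 → 0 < ⟪y, fderiv ℝ h xs y⟫

/-- `ρ, κ, μ, L` are local constants of `h` at `xs`: on the closed ball of radius `ρ`, the numbers
`μ` and `L` bound the Jacobian and its quadratic form, and `κ / 2` bounds the quadratic error of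
the linear model of `h` at `xs`. -/
structure LocalConstants {d : ℕ} (h : Vec d → Vec d) (xs : Vec d) (ρ κ μ L : ℝ) : Prop where
  norm_lower : ∀ x ∈ Metric.closedBall xs ρ, ∀ y : Vec d, μ * ‖y‖ ≤ ‖fderiv ℝ h x y‖
  norm_upper : ∀ x ∈ Metric.closedBall xs ρ, ∀ y : Vec d, ‖fderiv ℝ h x y‖ ≤ L * ‖y‖
  form_lower : ∀ x ∈ Metric.closedBall xs ρ, ∀ y : Vec d, μ * ‖y‖ ^ 2 ≤ ⟪y, fderiv ℝ h x y⟫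
  form_upper : ∀ x ∈ Metric.closedBall xs ρ, ∀ y : Vec d, ⟪y, fderiv ℝ h x y⟫ ≤ L * ‖y‖ ^ 2
  linear_error : ∀ x ∈ Metric.closedBall xs ρ,
    ‖h x - fderiv ℝ h xs (x - xs)‖ ≤ 1 / 2 * κ * ‖x - xs‖ ^ 2

/-- The operator `A = I - g'(xs)`. -/
def opA {d : ℕ} (g : Vec d → Vec d) (xs : Vec d) : Vec d →L[ℝ] Vec d :=
  ContinuousLinearMap.id ℝ (Vec d) - fderiv ℝ g xs

/-- The norm `‖y‖_A = (yᵀ A y)^{1/2}`, for symmetric positive definite `A`. -/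
def normA {d : ℕ} (A : Vec d →L[ℝ] Vec d) (y : Vec d) : ℝ := Real.sqrt ⟪y, A y⟫

/-- The number `‖I - b A‖₂` (the spectral norm), which is `θ_k` when `b = β_k`. -/
def mixNorm {d : ℕ} (A : Vec d →L[ℝ] Vec d) (b : ℝ) : ℝ :=
  ‖ContinuousLinearMap.id ℝ (Vec d) - b • A‖

/-- The factor `(√(L/μ) - 1) / (√(L/μ) + 1)`. -/
def chebRate (μ L : ℝ) : ℝ := (Real.sqrt (L / μ) - 1) / (Real.sqrt (L / μ) + 1)

end STAM

end

/-! Between two restarts the method is a small perturbation of a Krylov method for the linear system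
with matrix `A`, shifted so that the solution is 0. Let `B` be the form of `A` (Type-I) or of `A ^
2` (Type-II). In the linear case, subtracting the last two directions already makes the projected
error `y j` `B`-orthogonal to all previous directions: `A` is `B`-symmetric and maps each direction
into the span of the directions up to the next one (`LinRun.orth`). Those directions span a Krylov
space, so `y J` minimizes the `B`-norm over all `P(A) x₀` with `deg P ≤ J` and `P(0) = 1`. A
Chebyshev polynomial gives the factor `2 * chebRate ^ J`, the mixing step `I - βA` gives `mixNorm`,
and `d` nonzero orthogonal directions force `y d = 0`.

For the nonlinear method, the iterations since a restart at distance `e` from the solution are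
divided by `e`. The starting point then has norm 1, and the residual differs from `-A x` by at most
`ε ‖x‖²` with `ε = κ e`. Such a rescaled run is a `Block`. By induction every quantity of a block is
within `O(ε)` of its linear counterpart (`Model.tracks`); the divisions are harmless because the
test with `τ` keeps the denominators away from 0. The `O` is taken along a filter on the type of all
blocks with fixed parameters, so its constant does not depend on `g`. Scaling back turns `C ε` into
`C κ e²`.

It remains to keep all restart points near the solution. The competitor `P = 1` shows that the
energy norm shrinks by `θ` up to a quadratic term, which the gap `1 - θ` absorbs near the solution
(`normN_iterate_le`). -/

namespace STAM

/-! ### The linear short-recurrence iteration: orthogonality and optimality. -/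

section Exact

variable {E : Type*} [AddCommGroup E] [Module ℝ E]

/-- Subtract from `a` its projection onto `p` with respect to the bilinear form `B`. -/
noncomputable def elim (B : E →ₗ[ℝ] E →ₗ[ℝ] ℝ) (p a : E) : E := a - (B p a / B p p) • p

/-- The iteration with short recurrences for the linear system `A x = 0`, where the projections
are taken with respect to `B`. -/
structure LinRun (B : E →ₗ[ℝ] E →ₗ[ℝ] ℝ) (A : E →ₗ[ℝ] E) (β : ℕ → ℝ) (x y p : ℕ → E) :
    Prop where
  p_zero : p 0 = 0
  p_one : p 1 = x 1 - x 0
  p_succ : ∀ j, p (j + 2) = elim B (p (j + 1)) (elim B (p j) (x (j + 2) - x (j + 1)))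
  y_zero : y 0 = x 0
  y_succ : ∀ j, y (j + 1) = elim B (p (j + 1)) (elim B (p j) (x (j + 1)))
  x_succ : ∀ j, x (j + 1) = y j - β j • A (y j)

/-- `B` is an inner product for which `A` is symmetric and positive definite. -/
structure Compatible (B : E →ₗ[ℝ] E →ₗ[ℝ] ℝ) (A : E →ₗ[ℝ] E) : Prop where
  symm : ∀ u v, B u v = B v u
  pos : ∀ u, u ≠ 0 → 0 < B u u
  selfAdj : ∀ u v, B (A u) v = B u (A v)
  posA : ∀ u, u ≠ 0 → 0 < B (A u) u

/-- The span of the first directions. -/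
def dirSpan (p : ℕ → E) (j : ℕ) : Submodule ℝ E := Submodule.span ℝ (p '' Set.Iic j)

lemma mem_dirSpan (p : ℕ → E) {i j : ℕ} (h : i ≤ j) : p i ∈ dirSpan p j :=
  Submodule.subset_span ⟨i, h, rfl⟩

lemma dirSpan_mono (p : ℕ → E) {i j : ℕ} (h : i ≤ j) : dirSpan p i ≤ dirSpan p j :=
  Submodule.span_mono (Set.image_mono (Set.Iic_subset_Iic.2 h))

lemma apply_eq_zero_of_mem_dirSpan (B : E →ₗ[ℝ] E →ₗ[ℝ] ℝ) {p : ℕ → E} {j : ℕ} {w : E}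
    (h : ∀ i ≤ j, B (p i) w = 0) {u : E} (hu : u ∈ dirSpan p j) : B u w = 0 := by
  have : dirSpan p j ≤ LinearMap.ker (B.flip w) := by
    refine Submodule.span_le.2 ?_
    rintro _ ⟨i, hi, rfl⟩
    exact h i hi
  exact this hu

lemma elim_mem {B : E →ₗ[ℝ] E →ₗ[ℝ] ℝ} {p a : E} {S : Submodule ℝ E} (hp : p ∈ S) :
    elim B p a - a ∈ S := by
  have : elim B p a - a = -((B p a / B p p) • p) := by simp [elim]
  rw [this]
  exact S.neg_mem (S.smul_mem _ hp)

lemma elim_orth_of_orth {B : E →ₗ[ℝ] E →ₗ[ℝ] ℝ} {p a w : E} (h : B w p = 0) :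
    B w (elim B p a) = B w a := by
  simp [elim, h]

namespace Compatible

variable {B : E →ₗ[ℝ] E →ₗ[ℝ] ℝ} {A : E →ₗ[ℝ] E} (hB : Compatible B A)
include hB

lemma eq_zero {u : E} (h : B u u = 0) : u = 0 := by
  by_contra hu
  exact (hB.pos u hu).ne' h

lemma elim_orth (p a : E) : B p (elim B p a) = 0 := by
  by_cases hp : p = 0
  · simp [hp]
  · have := (hB.pos p hp).ne'
    simp [elim, this]

end Compatible

namespace LinRun

variable {B : E →ₗ[ℝ] E →ₗ[ℝ] ℝ} {A : E →ₗ[ℝ] E} {β : ℕ → ℝ} {x y p : ℕ → E}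
  (h : LinRun B A β x y p)
include h

lemma p_sub_mem (j : ℕ) : p (j + 1) - (x (j + 1) - x j) ∈ dirSpan p j := by
  rcases j with _ | j
  · simp [h.p_one]
  · rw [h.p_succ]
    have h1 := elim_mem (B := B) (a := elim B (p j) (x (j + 2) - x (j + 1)))
      (mem_dirSpan p (le_refl (j + 1)))
    have h2 := elim_mem (B := B) (a := x (j + 2) - x (j + 1)) (mem_dirSpan p (Nat.le_succ j))
    simpa using add_mem h1 h2

lemma y_sub_mem (j : ℕ) : y j - x j ∈ dirSpan p j := by
  rcases j with _ | j
  · simp [h.y_zero]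
  · rw [h.y_succ]
    have h1 := elim_mem (B := B) (a := elim B (p j) (x (j + 1))) (mem_dirSpan p (le_refl (j + 1)))
    have h2 := elim_mem (B := B) (a := x (j + 1)) (mem_dirSpan p (Nat.le_succ j))
    simpa using add_mem h1 h2

/-- Modulo the span of the first `j` directions, `y j` is `x j` and `p (j + 1)` is `x (j + 1) - x
j`; hence `β j • A (y j) = y j - x (j + 1)` is `-p (j + 1)` modulo that span. -/
lemma apply_y_mem (j : ℕ) (hβ : β j ≠ 0) : A (y j) ∈ dirSpan p (j + 1) := by
  have h1 := (dirSpan_mono p (Nat.le_succ j)) (h.p_sub_mem j)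
  have h2 := (dirSpan_mono p (Nat.le_succ j)) (h.y_sub_mem j)
  have h3 := sub_mem (add_mem h1 h2) (mem_dirSpan p (le_refl (j + 1)))
  have h4 : A (y j) = (β j)⁻¹ • (p (j + 1) - (x (j + 1) - x j) + (y j - x j) - p (j + 1)) := by
    rw [h.x_succ]
    have : p (j + 1) - (y j - β j • A (y j) - x j) + (y j - x j) - p (j + 1)
        = β j • A (y j) := by abel
    rw [this, smul_smul, inv_mul_cancel₀ hβ, one_smul]
  rw [h4]
  exact Submodule.smul_mem _ _ h3

/-- The orthogonality relations up to stage `j`. -/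
structure Orth (B : E →ₗ[ℝ] E →ₗ[ℝ] ℝ) (y p : ℕ → E) (j : ℕ) : Prop where
  dirs : ∀ i < j, B (p i) (p j) = 0
  err : ∀ i ≤ j, B (p i) (y j) = 0
  diff : ∀ i, j = i + 1 → ∃ c : ℝ, c ≠ 0 ∧ y (i + 1) - y i = c • p (i + 1)

/-- A direction is a multiple of the difference of two consecutive projected errors, and `A` of
those is controlled by `apply_y_mem`. This Hessenberg structure is what makes short recurrences
suffice. -/
lemma apply_p_mem {j : ℕ} (hβ : ∀ i < j, β i ≠ 0) (hj : ∀ i < j, Orth B y p i) (i : ℕ)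
    (hi : i + 1 ≤ j) : A (p i) ∈ dirSpan p (i + 1) := by
  rcases i with _ | i
  · simp [h.p_zero]
  · obtain ⟨c, hc, hd⟩ := (hj (i + 1) (by omega)).diff i rfl
    have : p (i + 1) = c⁻¹ • (y (i + 1) - y i) := by
      rw [hd, smul_smul, inv_mul_cancel₀ hc, one_smul]
    rw [this, map_smul, map_sub]
    exact Submodule.smul_mem _ _ (sub_mem (h.apply_y_mem _ (hβ _ (by omega)))
      (dirSpan_mono p (Nat.le_succ _) (h.apply_y_mem _ (hβ _ (by omega)))))

/-- The three relations support each other in one induction: `diff` at earlier stages locates `A (p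
i)`, which yields `dirs` and `err` at the next stage, and these yield `diff` there. -/
lemma orth (hB : Compatible B A) {J : ℕ} (hβ : ∀ i ≤ J, β i ≠ 0)
    (hp : ∀ i, 1 ≤ i → i ≤ J → p i ≠ 0) : ∀ j ≤ J, Orth B y p j := by
  intro j
  induction j using Nat.strong_induction_on with
  | _ j ih =>
  intro hjJ
  rcases j with _ | j
  · refine ⟨by simp, ?_, by simp⟩
    intro i hi
    obtain rfl : i = 0 := by omega
    simp [h.p_zero]
  have IH : ∀ i ≤ j, Orth B y p i := fun i hi => ih i (by omega) (by omega)
  -- Move `A` onto `p i`: the result lies in a span to which `y j` is already orthogonal. Older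
  -- directions therefore need no explicit elimination.
  have hAy : ∀ i, i + 1 ≤ j → B (p i) (A (y j)) = 0 := by
    intro i hi
    rw [← hB.selfAdj]
    refine apply_eq_zero_of_mem_dirSpan B (j := j) (IH j le_rfl).err ?_
    exact dirSpan_mono p hi (h.apply_p_mem (j := j) (fun i hi => hβ i (by omega))
      (fun i hi => IH i (by omega)) i hi)
  have hdirs : ∀ i < j + 1, B (p i) (p (j + 1)) = 0 := by
    intro i hi
    rcases j with _ | j
    · obtain rfl : i = 0 := by omega
      simp [h.p_zero]
    have hj1 := (IH (j + 1) le_rfl).dirs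
    rw [h.p_succ]
    by_cases h1 : i = j + 1
    · subst h1; exact hB.elim_orth _ _
    rw [elim_orth_of_orth (hj1 i (by omega))]
    by_cases h2 : i = j
    · subst h2; exact hB.elim_orth _ _
    rw [elim_orth_of_orth ((IH j (by omega)).dirs i (by omega))]
    have h3 : x (j + 2) - x (j + 1) = (y (j + 1) - x (j + 1)) - β (j + 1) • A (y (j + 1)) := by
      rw [h.x_succ (j + 1)]; abel
    have h4 : B (p i) (y (j + 1)) = B (p i) (x (j + 1)) := by
      rw [h.y_succ, elim_orth_of_orth (hj1 i (by omega)),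
        elim_orth_of_orth ((IH j (by omega)).dirs i (by omega))]
    rw [h3, map_sub, map_sub, map_smul, hAy i (by omega), h4]
    simp
  have herr : ∀ i ≤ j + 1, B (p i) (y (j + 1)) = 0 := by
    intro i hi
    rw [h.y_succ]
    by_cases h1 : i = j + 1
    · subst h1; exact hB.elim_orth _ _
    rw [elim_orth_of_orth (hdirs i (by omega))]
    by_cases h2 : i = j
    · subst h2; exact hB.elim_orth _ _
    rw [elim_orth_of_orth ((IH j (by omega)).dirs i (by omega)), h.x_succ, map_sub, map_smul,
      hAy i (by omega), (IH j le_rfl).err i (by omega)]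
    simp
  refine ⟨hdirs, herr, ?_⟩
  rintro i hi
  obtain rfl : j = i := by omega
  have hβj := hβ j (by omega)
  have hpj := hp (j + 1) (by omega) hjJ
  have hw : y (j + 1) - y j ∈ dirSpan p (j + 1) := by
    have h1 := h.y_sub_mem (j + 1)
    have h2 := Submodule.smul_mem _ (β j) (h.apply_y_mem j hβj)
    have h3 := sub_mem h1 h2
    rw [h.x_succ j] at h3
    convert h3 using 1
    abel
  obtain ⟨u, hu, c, hc⟩ : ∃ u ∈ dirSpan p j, ∃ c : ℝ, y (j + 1) - y j = u + c • p (j + 1) := by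
    have h1 : dirSpan p (j + 1) = dirSpan p j ⊔ Submodule.span ℝ {p (j + 1)} := by
      rw [dirSpan, dirSpan, ← Submodule.span_union]
      congr 1
      ext z
      simp only [Set.mem_image, Set.mem_Iic, Set.union_singleton, Set.mem_insert_iff]
      constructor
      · rintro ⟨i, hi, rfl⟩
        rcases Nat.lt_or_ge j i with h | h
        · left; congr 1; omega
        · right; exact ⟨i, h, rfl⟩
      · rintro (rfl | ⟨i, hi, rfl⟩)
        · exact ⟨_, le_rfl, rfl⟩
        · exact ⟨i, by omega, rfl⟩
    rw [h1] at hw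
    obtain ⟨u, hu, z, hz, huz⟩ := Submodule.mem_sup.1 hw
    obtain ⟨c, rfl⟩ := Submodule.mem_span_singleton.1 hz
    exact ⟨u, hu, c, huz.symm⟩
  have hVp : ∀ v ∈ dirSpan p j, B v (p (j + 1)) = 0 := fun v hv =>
    apply_eq_zero_of_mem_dirSpan B (fun i hi => hdirs i (by omega)) hv
  have hVy : ∀ v ∈ dirSpan p j, B v (y j) = 0 := fun v hv =>
    apply_eq_zero_of_mem_dirSpan B (IH j le_rfl).err hv
  have hVy' : ∀ v ∈ dirSpan p j, B v (y (j + 1)) = 0 := fun v hv =>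
    apply_eq_zero_of_mem_dirSpan B (fun i hi => herr i (by omega)) hv
  -- The component `u` is orthogonal to `p (j + 1)`, `y j` and `y (j + 1)`, hence to itself.
  have hu0 : u = 0 := by
    apply hB.eq_zero
    have h1 : u = (y (j + 1) - y j) - c • p (j + 1) := by rw [hc]; abel
    have h2 : B u u = B u ((y (j + 1) - y j) - c • p (j + 1)) := by rw [← h1]
    rw [h2, map_sub, map_sub, map_smul, hVp u hu, hVy u hu, hVy' u hu]
    simp
  rw [hu0, zero_add] at hc
  refine ⟨c, ?_, hc⟩
  -- If `c = 0`, then `y j = y (j + 1)` is orthogonal to `p (j + 1)`, so `B (A (y j)) (y j) = 0` and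
  -- `y j = 0`. Then `p (j + 1)` lies in the span to which it is orthogonal, so it vanishes, which
  -- is excluded.
  rintro rfl
  rw [zero_smul, sub_eq_zero] at hc
  set v := p (j + 1) - (x (j + 1) - x j) + (y j - x j) with hv
  have hvm : v ∈ dirSpan p j := add_mem (h.p_sub_mem j) (h.y_sub_mem j)
  have hpv : p (j + 1) = v - β j • A (y j) := by
    rw [hv, h.x_succ j]; abel
  have h0 : B (p (j + 1)) (y j) = 0 := by rw [← hc]; exact herr _ le_rfl
  rw [hpv, map_sub, map_smul, LinearMap.sub_apply, LinearMap.smul_apply, hVy v hvm, zero_sub,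
    neg_eq_zero, smul_eq_mul, mul_eq_zero, or_iff_right hβj] at h0
  have hy0 : y j = 0 := by
    by_contra hy
    exact (hB.posA _ hy).ne' h0
  rw [hy0, map_zero, smul_zero, sub_zero] at hpv
  apply hpj
  apply hB.eq_zero
  have := hVp v hvm
  rwa [← hpv] at this

/-- The projected error is no larger than the image of the initial error under any polynomial in
`A` of degree at most `J` that takes the value `1` at `0`. -/
lemma form_y_le (hB : Compatible B A) {J : ℕ} (hβ : ∀ i ≤ J, β i ≠ 0)
    (hp : ∀ i, 1 ≤ i → i ≤ J → p i ≠ 0) (P : Polynomial ℝ) (hP : P.natDegree ≤ J)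
    (hP0 : P.coeff 0 = 1) :
    B (y J) (y J) ≤ B (Polynomial.aeval A P (x 0)) (Polynomial.aeval A P (x 0)) := by
  have hO := h.orth hB hβ hp
  have hpow : ∀ i, i + 1 ≤ J → (A ^ (i + 1)) (x 0) ∈ dirSpan p (i + 1) := by
    intro i
    induction i with
    | zero =>
      intro hi
      rw [zero_add, pow_one, ← h.y_zero]
      exact h.apply_y_mem 0 (hβ 0 (by omega))
    | succ i ih =>
      intro hi
      have h1 := ih (by omega)
      have h2 : dirSpan p (i + 1) ≤ (dirSpan p (i + 2)).comap A := by
        refine Submodule.span_le.2 ?_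
        rintro _ ⟨k, hk, rfl⟩
        have hk' : k ≤ i + 1 := hk
        refine dirSpan_mono p (by omega : k + 1 ≤ i + 2) (h.apply_p_mem (j := J)
          (fun i hi => hβ i (by omega)) (fun i hi => hO i (by omega)) k (by omega))
      rw [pow_succ', Module.End.mul_apply]
      exact h2 h1
  have hy : ∀ j ≤ J, y j - x 0 ∈ dirSpan p j := by
    intro j
    induction j with
    | zero => intro _; simp [h.y_zero]
    | succ j ih =>
      intro hj
      obtain ⟨c, -, hc⟩ := (hO (j + 1) hj).diff j rfl
      have h1 := add_mem (dirSpan_mono p (Nat.le_succ j) (ih (by omega)))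
        (Submodule.smul_mem _ c (mem_dirSpan p (le_refl (j + 1))))
      rw [← hc] at h1
      convert h1 using 1
      abel
  set b := Polynomial.aeval A P (x 0) with hb
  have hbx : b - x 0 ∈ dirSpan p J := by
    have h1 : b = ∑ i ∈ Finset.range (J + 1), P.coeff i • (A ^ i) (x 0) := by
      rw [hb, Polynomial.aeval_eq_sum_range' (by omega : P.natDegree < J + 1)]
      simp [LinearMap.sum_apply]
    rw [h1, Finset.sum_range_succ', hP0]
    simp only [pow_zero, Module.End.one_apply, one_smul, add_sub_cancel_right]
    refine Submodule.sum_mem _ fun i hi => Submodule.smul_mem _ _ ?_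
    have : i + 1 ≤ J := by simpa using hi
    exact dirSpan_mono p this (hpow i this)
  have hs : b - y J ∈ dirSpan p J := by
    have := sub_mem hbx (hy J le_rfl)
    convert this using 1
    abel
  -- Pythagoras: `b - y J` lies in the span of the directions, to which `y J` is orthogonal.
  have h1 : B (b - y J) (y J) = 0 := apply_eq_zero_of_mem_dirSpan B (hO J le_rfl).err hs
  have h2 : 0 ≤ B (b - y J) (b - y J) := by
    by_cases h0 : b - y J = 0
    · simp [h0]
    · exact (hB.pos _ h0).le
  have h3 : B b b = B (b - y J) (b - y J) + 2 * B (b - y J) (y J) + B (y J) (y J) := by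
    have := hB.symm b (y J)
    simp only [map_sub, LinearMap.sub_apply]
    linarith
  rw [h3, h1]
  linarith

/-- After as many steps as there are dimensions the projected error vanishes. -/
lemma y_eq_zero (hB : Compatible B A) [FiniteDimensional ℝ E] {J : ℕ} (hβ : ∀ i ≤ J, β i ≠ 0)
    (hp : ∀ i, 1 ≤ i → i ≤ J → p i ≠ 0) (hJ : Module.finrank ℝ E = J) : y J = 0 := by
  have hO := h.orth hB hβ hp
  have hli : LinearIndependent ℝ (fun i : Fin J => p (i + 1)) := by
    refine LinearMap.BilinForm.linearIndependent_of_iIsOrtho (B := B) ?_ ?_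
    · intro i j hij
      change B (p (i + 1)) (p (j + 1)) = 0
      rcases lt_or_gt_of_ne hij with hlt | hlt
      · exact (hO (j + 1) (by omega)).dirs _ (by simpa using hlt)
      · rw [hB.symm]
        exact (hO (i + 1) (by omega)).dirs _ (by simpa using hlt)
    · intro i
      exact (hB.pos _ (hp _ (by omega) (by omega))).ne'
  have htop := hli.span_eq_top_of_card_eq_finrank' (by simp [hJ])
  have hmem : y J ∈ dirSpan p J := by
    have hle : Submodule.span ℝ (Set.range fun i : Fin J => p (i + 1)) ≤ dirSpan p J := by
      refine Submodule.span_le.2 ?_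
      rintro _ ⟨i, rfl⟩
      exact mem_dirSpan p (by omega)
    rw [htop] at hle
    exact hle trivial
  exact hB.eq_zero (apply_eq_zero_of_mem_dirSpan B (hO J le_rfl).err hmem)

end LinRun

end Exact

/-! ### Polynomials of a symmetric operator. -/

section Spectral

variable {E : Type*} [NormedAddCommGroup E] [InnerProductSpace ℝ E] [FiniteDimensional ℝ E]

open Polynomial in
-- Both sides are diagonal in an eigenbasis of `A`. The polynomial `W` is a nonnegative spectral
-- weight, so that `X` and `X ^ 2` treat the two types at once.
lemma inner_aeval_le {A : E →ₗ[ℝ] E} (hA : A.IsSymmetric) (P W : ℝ[X]) {M : ℝ}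
    (hW : ∀ t, Module.End.HasEigenvalue A t → 0 ≤ W.eval t)
    (hP : ∀ t, Module.End.HasEigenvalue A t → |P.eval t| ≤ M) (y : E) :
    ⟪aeval A P y, aeval A W (aeval A P y)⟫ ≤ M ^ 2 * ⟪y, aeval A W y⟫ := by
  set b := hA.eigenvectorBasis rfl with hb
  set t := hA.eigenvalues rfl with ht
  have hev : ∀ i, Module.End.HasEigenvector A (t i) (b i) := fun i => by
    simpa using hA.hasEigenvector_eigenvectorBasis rfl i
  have hval : ∀ i, Module.End.HasEigenvalue A (t i) := fun i =>
    Module.End.hasEigenvalue_of_hasEigenvector (hev i)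
  have happ : ∀ (Q : ℝ[X]) (i) (z : E), ⟪b i, aeval A Q z⟫ = Q.eval (t i) * ⟪b i, z⟫ := by
    intro Q i z
    have hz : z = ∑ j, ⟪b j, z⟫ • b j := (b.sum_repr' z).symm
    have h1 : aeval A Q z = ∑ j, (⟪b j, z⟫ * Q.eval (t j)) • b j := by
      conv_lhs => rw [hz]
      rw [map_sum]
      refine Finset.sum_congr rfl fun j _ => ?_
      rw [map_smul, Module.End.aeval_apply_of_hasEigenvector (hev j), smul_smul]
    rw [h1, inner_sum]
    simp_rw [real_inner_smul_right, orthonormal_iff_ite.1 b.orthonormal]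
    simp [mul_comm]
  rw [← b.sum_inner_mul_inner, ← b.sum_inner_mul_inner y, Finset.mul_sum]
  refine Finset.sum_le_sum fun i _ => ?_
  rw [real_inner_comm, happ, happ, happ, happ, real_inner_comm y]
  have h1 : (P.eval (t i)) ^ 2 ≤ M ^ 2 := sq_le_sq' (abs_le.1 (hP _ (hval i))).1
    (abs_le.1 (hP _ (hval i))).2
  have h2 := mul_le_mul_of_nonneg_right h1
    (mul_nonneg (hW _ (hval i)) (sq_nonneg ⟪y, b i⟫))
  linarith

omit [FiniteDimensional ℝ E] in
lemma eigenvalue_mem_Icc {A : E →ₗ[ℝ] E} {μ L : ℝ} (hl : ∀ y, μ * ‖y‖ ^ 2 ≤ ⟪y, A y⟫)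
    (hu : ∀ y, ⟪y, A y⟫ ≤ L * ‖y‖ ^ 2) {t : ℝ} (ht : Module.End.HasEigenvalue A t) :
    t ∈ Set.Icc μ L := by
  obtain ⟨v, hv⟩ := ht.exists_hasEigenvector
  have h0 : 0 < ‖v‖ ^ 2 := pow_pos (norm_pos_iff.2 hv.2) 2
  have h1 : ⟪v, A v⟫ = t * ‖v‖ ^ 2 := by
    rw [hv.apply_eq_smul, real_inner_smul_right, real_inner_self_eq_norm_sq]
  have h2 := hl v
  have h3 := hu v
  rw [h1] at h2 h3
  exact ⟨le_of_mul_le_mul_right h2 h0, le_of_mul_le_mul_right h3 h0⟩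

end Spectral

/-! ### The Chebyshev bound. -/

section Chebyshev

open Polynomial

lemma chebRate_nonneg {μ L : ℝ} (hμ : 0 < μ) (h : μ ≤ L) : 0 ≤ chebRate μ L := by
  have h1 : 1 ≤ Real.sqrt (L / μ) := Real.one_le_sqrt.2 ((one_le_div hμ).2 h)
  unfold chebRate
  exact div_nonneg (by linarith) (by linarith)

/-- Take `P(t) = T_J(ℓ(t)) / T_J(σ)`, where the affine map `ℓ` sends `[μ, L]` to `[-1, 1]` and 0 to
`σ`. Since `σ = cosh (log w)` for the rate `w`, the denominator is `(w ^ J + w ^ (-J)) / 2`. -/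
lemma exists_chebyshev {μ L : ℝ} (hμ : 0 < μ) (h : μ ≤ L) (J : ℕ) :
    ∃ P : ℝ[X], P.natDegree ≤ J ∧ P.coeff 0 = 1 ∧
      ∀ t ∈ Set.Icc μ L, |P.eval t| ≤ 2 * chebRate μ L ^ J := by
  -- For `μ = L` the interval is a point and `ℓ` is undefined; the rate is 0, and `1 - t / μ`
  -- vanishes at that point.
  rcases h.eq_or_lt with rfl | hlt
  · rcases J with _ | J
    · exact ⟨1, by simp, by simp, by simp⟩
    · refine ⟨1 - C μ⁻¹ * X, ?_, by simp, ?_⟩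
      · refine (natDegree_sub_le _ _).trans ?_
        have := natDegree_C_mul_le μ⁻¹ (X : ℝ[X])
        rw [natDegree_X] at this
        simp only [natDegree_one]
        omega
      · intro t ht
        obtain rfl : μ = t := le_antisymm ht.1 ht.2
        simp [chebRate, hμ.ne']
  set s := Real.sqrt (L / μ) with hs
  have hs2 : s ^ 2 = L / μ := Real.sq_sqrt (div_nonneg (hμ.le.trans h) hμ.le)
  have hs1 : 1 < s := by
    rw [hs]
    exact Real.lt_sqrt_of_sq_lt (by rw [one_pow]; exact (one_lt_div hμ).2 hlt)
  set w := chebRate μ L with hw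
  have hw' : w = (s - 1) / (s + 1) := rfl
  have hwpos : 0 < w := by rw [hw']; exact div_pos (by linarith) (by linarith)
  set σ := (L + μ) / (L - μ) with hσ
  have hLμ : 0 < L - μ := by linarith
  have hcosh : Real.cosh (Real.log w) = σ := by
    rw [Real.cosh_log hwpos, hw', hσ]
    have hL : L = s ^ 2 * μ := by rw [hs2]; field_simp
    rw [hL]
    have e1 : s ^ 2 * μ - μ = μ * ((s - 1) * (s + 1)) := by ring
    have e2 : s - 1 ≠ 0 := by linarith
    have e3 : s + 1 ≠ 0 := by linarith
    rw [e1]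
    field_simp
    ring
  set K := (Chebyshev.T ℝ (J : ℤ)).eval σ with hK
  have hKlow : (w ^ J)⁻¹ ≤ 2 * K := by
    rw [hK, ← hcosh, Chebyshev.T_real_cosh, Real.cosh_eq]
    have e1 : Real.exp (-(((J : ℤ) : ℝ) * Real.log w)) = (w ^ J)⁻¹ := by
      rw [Real.exp_neg, Int.cast_natCast, Real.exp_nat_mul, Real.exp_log hwpos]
    rw [e1]
    have := Real.exp_pos (((J : ℤ) : ℝ) * Real.log w)
    linarith
  have hwJ : 0 < w ^ J := pow_pos hwpos J
  have hKpos : 0 < K := by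
    have := inv_pos.2 hwJ
    linarith
  have hKinv : K⁻¹ ≤ 2 * w ^ J := by
    rw [inv_le_comm₀ hKpos (by positivity), mul_inv]
    linarith
  set ℓ : ℝ[X] := C σ - C (2 / (L - μ)) * X with hℓ
  have hdℓ : ℓ.natDegree ≤ 1 := by
    refine (natDegree_sub_le _ _).trans ?_
    have := natDegree_C_mul_le (2 / (L - μ)) (X : ℝ[X])
    rw [natDegree_X] at this
    simp only [natDegree_C]
    omega
  refine ⟨C K⁻¹ * (Chebyshev.T ℝ (J : ℤ)).comp ℓ, ?_, ?_, ?_⟩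
  · refine (natDegree_C_mul_le _ _).trans ?_
    refine natDegree_comp_le.trans ?_
    have h1 : (Chebyshev.T ℝ (J : ℤ)).natDegree = J := by simp
    rw [h1]
    exact (Nat.mul_le_mul_left J hdℓ).trans (by omega)
  · rw [coeff_zero_eq_eval_zero]
    simp only [hℓ, eval_mul, eval_C, eval_comp, eval_sub, eval_X, mul_zero, sub_zero]
    rw [← hK]
    exact inv_mul_cancel₀ hKpos.ne'
  · intro t ht
    have e1 : ℓ.eval t = (L + μ - 2 * t) / (L - μ) := by
      simp only [hℓ, hσ, eval_mul, eval_C, eval_sub, eval_X]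
      ring
    have e2 : |(ℓ.eval t)| ≤ 1 := by
      rw [e1, abs_div, abs_of_pos hLμ, div_le_one hLμ, abs_le]
      constructor <;> linarith [ht.1, ht.2]
    have e3 := Chebyshev.abs_eval_T_real_le_one (J : ℤ) e2
    rw [eval_mul, eval_C, eval_comp, abs_mul, abs_of_pos (inv_pos.2 hKpos)]
    calc K⁻¹ * |eval (eval t ℓ) (Chebyshev.T ℝ (J : ℤ))| ≤ K⁻¹ * 1 :=
          mul_le_mul_of_nonneg_left e3 (inv_pos.2 hKpos).le
      _ ≤ _ := by linarith

end Chebyshev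

/-! ### Calculus of `O(ε)` approximation for bounded families. -/

section Near

open Asymptotics Filter

variable {Ω : Type*} {l : Filter Ω} {ε : Ω → ℝ}
  {F : Type*} [NormedAddCommGroup F] [InnerProductSpace ℝ F]
  {G : Type*} [NormedAddCommGroup G]

/-- `f` agrees with the bounded family `f'` up to an error of order `ε`. -/
structure Near (l : Filter Ω) (ε : Ω → ℝ) (f f' : Ω → G) : Prop where
  bdd : f' =O[l] (fun _ => (1 : ℝ))
  err : (fun ω => f ω - f' ω) =O[l] ε

/-- `f` is bounded away from `0`. -/
def Away (l : Filter Ω) (f : Ω → ℝ) : Prop := ∃ c > 0, ∀ᶠ ω in l, c ≤ |f ω|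

lemma isBigO_of_norm_le_mul {G₁ G₂ : Type*} [NormedAddCommGroup G₁] [NormedAddCommGroup G₂]
    {f : Ω → G} {g : Ω → G₁} {k : Ω → G₂} {u v : Ω → ℝ} (h : ∀ ω, ‖f ω‖ ≤ ‖g ω‖ * ‖k ω‖)
    (hg : g =O[l] u) (hk : k =O[l] v) : f =O[l] (fun ω => u ω * v ω) := by
  refine (IsBigO.of_norm_le (g := fun ω => ‖g ω‖ * ‖k ω‖) fun ω => ?_).trans
    (hg.norm_left.mul hk.norm_left)
  exact h ω

namespace Near

lemma refl {f : Ω → G} (hf : f =O[l] (fun _ => (1 : ℝ))) : Near l ε f f :=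
  ⟨hf, by simpa using isBigO_zero ε l⟩

lemma congr {f f' g g' : Ω → G} (h : Near l ε f f') (h1 : ∀ ω, f ω = g ω)
    (h2 : ∀ ω, f' ω = g' ω) : Near l ε g g' := by
  obtain rfl : f = g := funext h1
  obtain rfl : f' = g' := funext h2
  exact h

lemma zero : Near l ε (fun _ => (0 : G)) (fun _ => 0) := refl (isBigO_zero _ l)

lemma bdd_left {f f' : Ω → G} (h : Near l ε f f') (hε : Tendsto ε l (𝓝 0)) :
    f =O[l] (fun _ => (1 : ℝ)) := by
  have h1 := (h.err.trans (hε.isBigO_one ℝ)).add h.bdd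
  refine h1.congr_left fun ω => ?_
  abel

lemma add {f f' g g' : Ω → G} (h : Near l ε f f') (k : Near l ε g g') :
    Near l ε (fun ω => f ω + g ω) (fun ω => f' ω + g' ω) :=
  ⟨h.bdd.add k.bdd, (h.err.add k.err).congr_left fun ω => by abel⟩

lemma neg {f f' : Ω → G} (h : Near l ε f f') :
    Near l ε (fun ω => -f ω) (fun ω => -f' ω) :=
  ⟨h.bdd.neg_left, h.err.neg_left.congr_left fun ω => by abel⟩

lemma sub {f f' g g' : Ω → G} (h : Near l ε f f') (k : Near l ε g g') :
    Near l ε (fun ω => f ω - g ω) (fun ω => f' ω - g' ω) :=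
  ⟨h.bdd.sub k.bdd, (h.err.sub k.err).congr_left fun ω => by abel⟩

lemma smul {c c' : Ω → ℝ} {f f' : Ω → F} (h : Near l ε c c') (k : Near l ε f f')
    (hε : Tendsto ε l (𝓝 0)) :
    Near l ε (fun ω => c ω • f ω) (fun ω => c' ω • f' ω) := by
  refine ⟨?_, ?_⟩
  · simpa using isBigO_of_norm_le_mul (fun ω => (norm_smul (c' ω) (f' ω)).le) h.bdd k.bdd
  · have h1 := isBigO_of_norm_le_mul (fun ω => (norm_smul (c ω - c' ω) (f ω)).le)
      h.err (k.bdd_left hε)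
    have h2 := isBigO_of_norm_le_mul (fun ω => (norm_smul (c' ω) (f ω - f' ω)).le) h.bdd k.err
    simp only [mul_one, one_mul] at h1 h2
    refine (h1.add h2).congr_left fun ω => ?_
    rw [sub_smul, smul_sub]
    abel

lemma inner {f f' g g' : Ω → F} (h : Near l ε f f') (k : Near l ε g g')
    (hε : Tendsto ε l (𝓝 0)) :
    Near l ε (fun ω => ⟪f ω, g ω⟫) (fun ω => ⟪f' ω, g' ω⟫) := by
  refine ⟨?_, ?_⟩
  · simpa using isBigO_of_norm_le_mul (fun ω => norm_inner_le_norm (𝕜 := ℝ) (f' ω) (g' ω))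
      h.bdd k.bdd
  · have h1 := isBigO_of_norm_le_mul (fun ω => norm_inner_le_norm (𝕜 := ℝ) (f ω - f' ω) (g ω))
      h.err (k.bdd_left hε)
    have h2 := isBigO_of_norm_le_mul (fun ω => norm_inner_le_norm (𝕜 := ℝ) (f' ω) (g ω - g' ω))
      h.bdd k.err
    simp only [mul_one, one_mul] at h1 h2
    refine (h1.add h2).congr_left fun ω => ?_
    rw [inner_sub_left, inner_sub_right]
    abel

lemma apply {A : Ω → F →L[ℝ] F} (hA : A =O[l] (fun _ => (1 : ℝ))) {f f' : Ω → F}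
    (h : Near l ε f f') : Near l ε (fun ω => A ω (f ω)) (fun ω => A ω (f' ω)) := by
  refine ⟨?_, ?_⟩
  · simpa using isBigO_of_norm_le_mul (fun ω => (A ω).le_opNorm (f' ω)) hA h.bdd
  · have h1 := isBigO_of_norm_le_mul (fun ω => (A ω).le_opNorm (f ω - f' ω)) hA h.err
    simp only [one_mul] at h1
    exact h1.congr_left fun ω => map_sub _ _ _

lemma away {f f' : Ω → ℝ} (h : Near l ε f f') (hε : Tendsto ε l (𝓝 0)) (hf : Away l f) :
    Away l f' := by
  obtain ⟨c, hc, hcf⟩ := hf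
  refine ⟨c / 2, half_pos hc, ?_⟩
  have h1 := (h.err.trans_tendsto hε).norm.eventually_lt_const
    (by simpa using half_pos hc : ‖(0 : ℝ)‖ < c / 2)
  filter_upwards [hcf, h1] with ω h2 h3
  rw [Real.norm_eq_abs] at h3
  have := abs_sub_abs_le_abs_sub (f ω) (f' ω)
  linarith

lemma symm {f f' : Ω → G} (h : Near l ε f f') (hε : Tendsto ε l (𝓝 0)) : Near l ε f' f :=
  ⟨h.bdd_left hε, h.err.neg_left.congr_left fun ω => by abel⟩

end Near

lemma Away.inv_isBigO {f : Ω → ℝ} (h : Away l f) : (fun ω => (f ω)⁻¹) =O[l] (fun _ => (1 : ℝ)) := by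
  obtain ⟨c, hc, hcf⟩ := h
  refine IsBigO.of_bound c⁻¹ ?_
  filter_upwards [hcf] with ω hω
  simpa using inv_anti₀ hc hω

lemma Away.ne_zero {f : Ω → ℝ} (h : Away l f) : ∀ᶠ ω in l, f ω ≠ 0 := by
  obtain ⟨c, hc, hcf⟩ := h
  filter_upwards [hcf] with ω hω h0
  rw [h0, abs_zero] at hω
  linarith

lemma Near.inv {f f' : Ω → ℝ} (h : Near l ε f f') (hε : Tendsto ε l (𝓝 0)) (hf : Away l f) :
    Near l ε (fun ω => (f ω)⁻¹) (fun ω => (f' ω)⁻¹) := by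
  have hf' := h.away hε hf
  refine ⟨hf'.inv_isBigO, ?_⟩
  have h1 := (h.err.neg_left.mul hf.inv_isBigO).mul hf'.inv_isBigO
  simp only [mul_one] at h1
  refine h1.congr' ?_ EventuallyEq.rfl
  filter_upwards [hf.ne_zero, hf'.ne_zero] with ω h2 h3
  field_simp
  ring

lemma Near.div {f f' g g' : Ω → ℝ} (h : Near l ε f f') (k : Near l ε g g')
    (hε : Tendsto ε l (𝓝 0)) (hg : Away l g) :
    Near l ε (fun ω => f ω / g ω) (fun ω => f' ω / g' ω) :=
  (h.smul (k.inv hε hg) hε).congr (fun ω => by simp [div_eq_mul_inv])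
    (fun ω => by simp [div_eq_mul_inv])

end Near

/-! ### The energy form of the two types. -/

section LinearModel

variable {E : Type*} [NormedAddCommGroup E] [InnerProductSpace ℝ E]

/-- The operator whose quadratic form is minimized by the projections: `A` for Type-I and
`A ^ 2` for Type-II. -/
noncomputable def opN : AMType → (E →L[ℝ] E) → (E →L[ℝ] E)
  | .typeI, A => A
  | .typeII, A => A.comp A

/-- The bilinear form `(u, v) ↦ uᵀ N v`. -/
noncomputable def formOf (ty : AMType) (A : E →L[ℝ] E) : E →ₗ[ℝ] E →ₗ[ℝ] ℝ :=
  (innerₗ E).compl₂ (opN ty A : E →ₗ[ℝ] E)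

lemma formOf_apply (ty : AMType) (A : E →L[ℝ] E) (u v : E) :
    formOf ty A u v = ⟪u, opN ty A v⟫ := rfl

/-- `A` is symmetric with spectrum in `[μ, L]`. -/
structure Elliptic (A : E →L[ℝ] E) (μ L : ℝ) : Prop where
  symm : ∀ u v, ⟪A u, v⟫ = ⟪u, A v⟫
  lower : ∀ y, μ * ‖y‖ ^ 2 ≤ ⟪y, A y⟫
  upper : ∀ y, ⟪y, A y⟫ ≤ L * ‖y‖ ^ 2
  norm_upper : ∀ y, ‖A y‖ ≤ L * ‖y‖

namespace Elliptic

variable {A : E →L[ℝ] E} {μ L : ℝ} (h : Elliptic A μ L)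
include h

lemma norm_lower (y : E) : μ * ‖y‖ ≤ ‖A y‖ := by
  by_cases hy : y = 0
  · simp [hy]
  have h0 := norm_pos_iff.2 hy
  have h1 := (h.lower y).trans (real_inner_le_norm y (A y))
  refine le_of_mul_le_mul_left ?_ h0
  linarith

lemma formOf_symm (ty : AMType) (u v : E) : formOf ty A u v = formOf ty A v u := by
  rw [formOf_apply, formOf_apply]
  cases ty
  · rw [opN, ← h.symm, real_inner_comm]
  · rw [opN, ContinuousLinearMap.comp_apply, ContinuousLinearMap.comp_apply, ← h.symm, ← h.symm,
      real_inner_comm]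

lemma formOf_self_lower (hμ : 0 < μ) (ty : AMType) (u : E) :
    min μ (μ ^ 2) * ‖u‖ ^ 2 ≤ formOf ty A u u := by
  cases ty
  · exact (mul_le_mul_of_nonneg_right (min_le_left _ _) (sq_nonneg _)).trans (h.lower u)
  · refine (mul_le_mul_of_nonneg_right (min_le_right _ _) (sq_nonneg _)).trans ?_
    rw [formOf_apply, opN, ContinuousLinearMap.comp_apply, ← h.symm, real_inner_self_eq_norm_sq,
      ← mul_pow]
    exact pow_le_pow_left₀ (by positivity) (h.norm_lower u) 2

lemma formOf_self_upper (ty : AMType) (u : E) :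
    formOf ty A u u ≤ max L (L ^ 2) * ‖u‖ ^ 2 := by
  cases ty
  · exact (h.upper u).trans (mul_le_mul_of_nonneg_right (le_max_left _ _) (sq_nonneg _))
  · refine le_trans ?_ (mul_le_mul_of_nonneg_right (le_max_right _ _) (sq_nonneg _))
    rw [formOf_apply, opN, ContinuousLinearMap.comp_apply, ← h.symm, real_inner_self_eq_norm_sq,
      ← mul_pow]
    exact pow_le_pow_left₀ (norm_nonneg _) (h.norm_upper u) 2

lemma compatible (hμ : 0 < μ) (ty : AMType) : Compatible (formOf ty A) (A : E →ₗ[ℝ] E) where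
  symm := h.formOf_symm ty
  pos u hu := by
    have := norm_pos_iff.2 hu
    have hc : 0 < min μ (μ ^ 2) := lt_min hμ (by positivity)
    exact lt_of_lt_of_le (by positivity) (h.formOf_self_lower hμ ty u)
  selfAdj u v := by
    rw [formOf_apply, formOf_apply]
    cases ty <;> exact h.symm _ _
  posA u hu := by
    rw [h.formOf_symm, formOf_apply]
    have hpos : ∀ w : E, w ≠ 0 → 0 < ⟪w, A w⟫ := fun w hw => by
      have := norm_pos_iff.2 hw
      exact lt_of_lt_of_le (by positivity) (h.lower w)
    have hAu : A u ≠ 0 := by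
      have := norm_pos_iff.2 hu
      exact norm_pos_iff.1 (lt_of_lt_of_le (by positivity) (h.norm_lower u))
    cases ty
    · change 0 < ⟪u, A (A u)⟫
      rw [← h.symm, real_inner_self_eq_norm_sq]
      have := norm_pos_iff.2 hAu
      positivity
    · change 0 < ⟪u, A (A (A u))⟫
      rw [← h.symm]
      exact hpos _ hAu

end Elliptic

end LinearModel

/-! ### Existence of the linear iteration. -/

section LinState

variable {E : Type*} [AddCommGroup E] [Module ℝ E]

/-- The part of the history that the linear iteration with short recurrences remembers. -/
structure LinState (E : Type*) where
  xprev : E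
  x : E
  pprev : E
  p : E

variable (B : E →ₗ[ℝ] E →ₗ[ℝ] ℝ) (A : E →ₗ[ℝ] E) (β : ℕ → ℝ) (x₀ : E)

/-- The direction computed from a state of the linear iteration. -/
noncomputable def LinState.dir (s : LinState E) : E := elim B s.p (elim B s.pprev (s.x - s.xprev))

/-- The projected point computed from a state of the linear iteration. -/
noncomputable def LinState.proj (s : LinState E) : E := elim B (s.dir B) (elim B s.p s.x)

/-- The states of the linear iteration. -/
noncomputable def linState : ℕ → LinState E
  -- Setting `x_{-1} = x_0` and `p_{-1} = p_{-2} = 0` makes the general rule produce `p 0 = 0` and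
  -- `p 1 = x 1 - x 0`.
  | 0 => ⟨x₀, x₀, 0, 0⟩
  | j + 1 =>
    let s := linState j
    ⟨s.x, s.proj B - β j • A (s.proj B), s.p, s.dir B⟩

lemma exists_linRun : ∃ x y p : ℕ → E, x 0 = x₀ ∧ LinRun B A β x y p := by
  have e0 : ∀ a : E, elim B 0 a = a := fun a => by simp [elim]
  have hp0 : ((linState B A β x₀ 0).dir B) = 0 := by simp [LinState.dir, linState, e0]
  refine ⟨fun j => (linState B A β x₀ j).x, fun j => (linState B A β x₀ j).proj B,
    fun j => (linState B A β x₀ j).dir B, rfl, ?_⟩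
  refine ⟨hp0, ?_, fun j => rfl, ?_, fun j => rfl, fun j => rfl⟩
  · change elim B ((linState B A β x₀ 0).dir B) (elim B 0 _) = _
    rw [hp0, e0, e0]
    rfl
  · change elim B ((linState B A β x₀ 0).dir B) (elim B 0 _) = _
    rw [hp0, e0, e0]

end LinState

/-! ### The energy norm. -/

section EnergyNorm

variable {E : Type*} [NormedAddCommGroup E] [InnerProductSpace ℝ E]

/-- The norm induced by `formOf ty A`. -/
noncomputable def normN (ty : AMType) (A : E →L[ℝ] E) (u : E) : ℝ := Real.sqrt (formOf ty A u u)

lemma normN_typeII {A : E →L[ℝ] E} (hA : ∀ u v, ⟪A u, v⟫ = ⟪u, A v⟫) (u : E) :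
    normN .typeII A u = ‖A u‖ := by
  rw [normN, formOf_apply, opN, ContinuousLinearMap.comp_apply, ← hA, real_inner_self_eq_norm_sq,
    Real.sqrt_sq (norm_nonneg _)]

lemma normN_smul (ty : AMType) (A : E →L[ℝ] E) (c : ℝ) (u : E) :
    normN ty A (c • u) = |c| * normN ty A u := by
  rw [normN]
  simp only [map_smul, LinearMap.smul_apply, smul_eq_mul]
  rw [← mul_assoc, Real.sqrt_mul (mul_self_nonneg c), Real.sqrt_mul_self_eq_abs, normN]

lemma normN_nonneg (ty : AMType) (A : E →L[ℝ] E) (u : E) : 0 ≤ normN ty A u := Real.sqrt_nonneg _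

namespace Elliptic

variable {A : E →L[ℝ] E} {μ L : ℝ} (h : Elliptic A μ L)
include h

lemma formOf_self_nonneg (hμ : 0 < μ) (ty : AMType) (u : E) : 0 ≤ formOf ty A u u := by
  have hc : 0 < min μ (μ ^ 2) := lt_min hμ (by positivity)
  exact le_trans (by positivity) (h.formOf_self_lower hμ ty u)

lemma normN_sq (hμ : 0 < μ) (ty : AMType) (u : E) : normN ty A u ^ 2 = formOf ty A u u :=
  Real.sq_sqrt (h.formOf_self_nonneg hμ ty u)

lemma normN_add_le (hμ : 0 < μ) (ty : AMType) (u v : E) :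
    normN ty A (u + v) ≤ normN ty A u + normN ty A v := by
  have h0 := LinearMap.BilinForm.apply_sq_le_of_symm (formOf ty A) (h.formOf_self_nonneg hμ ty)
    ⟨h.formOf_symm ty⟩ u v
  rw [← h.normN_sq hμ, ← h.normN_sq hμ, ← mul_pow] at h0
  have h1 : formOf ty A u v ≤ normN ty A u * normN ty A v :=
    (abs_le_of_sq_le_sq' h0 (mul_nonneg (normN_nonneg _ _ _) (normN_nonneg _ _ _))).2
  refine Real.sqrt_le_iff.2 ⟨add_nonneg (normN_nonneg _ _ _) (normN_nonneg _ _ _), ?_⟩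
  simp only [map_add, LinearMap.add_apply]
  rw [h.formOf_symm ty v u, ← h.normN_sq hμ, ← h.normN_sq hμ]
  linarith

lemma normN_upper (ty : AMType) (u : E) :
    normN ty A u ≤ Real.sqrt (max L (L ^ 2)) * ‖u‖ := by
  rw [← Real.sqrt_sq (norm_nonneg u), ← Real.sqrt_mul' _ (sq_nonneg _)]
  exact Real.sqrt_le_sqrt (h.formOf_self_upper ty u)

lemma normN_lower (hμ : 0 < μ) (ty : AMType) (u : E) :
    Real.sqrt (min μ (μ ^ 2)) * ‖u‖ ≤ normN ty A u := by
  rw [← Real.sqrt_sq (norm_nonneg u), ← Real.sqrt_mul' _ (sq_nonneg _)]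
  exact Real.sqrt_le_sqrt (h.formOf_self_lower hμ ty u)

open Polynomial in
lemma normN_aeval_le [FiniteDimensional ℝ E] (hμ : 0 < μ) (ty : AMType) (P : ℝ[X]) {M : ℝ}
    (hM : 0 ≤ M) (hP : ∀ t, Module.End.HasEigenvalue (A : E →ₗ[ℝ] E) t → |P.eval t| ≤ M) (y : E) :
    normN ty A (aeval (A : E →ₗ[ℝ] E) P y) ≤ M * normN ty A y := by
  obtain ⟨W, hW, hW'⟩ : ∃ W : ℝ[X], (∀ u, opN ty A u = aeval (A : E →ₗ[ℝ] E) W u) ∧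
      ∀ t > 0, 0 ≤ W.eval t := by
    cases ty
    · exact ⟨X, fun u => by simp [opN], fun t ht => by simpa using ht.le⟩
    · exact ⟨X ^ 2, fun u => by simp [opN, pow_two], fun t ht => by simp; positivity⟩
  have h1 := inner_aeval_le (A := (A : E →ₗ[ℝ] E)) h.symm P W (M := M) (fun t ht => hW' t
    (hμ.trans_le (eigenvalue_mem_Icc (A := (A : E →ₗ[ℝ] E)) h.lower h.upper ht).1)) hP y
  rw [← hW, ← hW, ← formOf_apply, ← formOf_apply] at h1
  refine Real.sqrt_le_iff.2 ⟨mul_nonneg hM (normN_nonneg _ _ _), ?_⟩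
  rwa [mul_pow, h.normN_sq hμ]

end Elliptic

lemma abs_one_sub_mul_le_of_hasEigenvalue {A : E →L[ℝ] E} (b t : ℝ)
    (ht : Module.End.HasEigenvalue (A : E →ₗ[ℝ] E) t) :
    |1 - b * t| ≤ ‖ContinuousLinearMap.id ℝ E - b • A‖ := by
  obtain ⟨v, hv⟩ := ht.exists_hasEigenvector
  have h0 := norm_pos_iff.2 hv.2
  have h1 := (ContinuousLinearMap.id ℝ E - b • A).le_opNorm v
  have h2 : A v = t • v := hv.apply_eq_smul
  have h3 : (ContinuousLinearMap.id ℝ E - b • A) v = (1 - b * t) • v := by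
    simp [h2, sub_smul, mul_smul]
  rw [h3, norm_smul, Real.norm_eq_abs] at h1
  exact le_of_mul_le_mul_right h1 h0

end EnergyNorm

/-! ### Mixing parameters. -/

section Mix

variable {d : ℕ} {A : Vec d →L[ℝ] Vec d} {μ L θ b : ℝ}

lemma mixNorm_nonneg (A : Vec d →L[ℝ] Vec d) (b : ℝ) : 0 ≤ mixNorm A b := norm_nonneg _

/-- Test `I - b A` on `u`: the number `b ⟪u, A u⟫` lies within `θ ‖u‖²` of `‖u‖²`. The lower bound
later keeps the first direction of a block from degenerating. -/
lemma Elliptic.mix_bounds (h : Elliptic A μ L) (hμ : 0 < μ) (hθ : θ < 1) (hb : mixNorm A b ≤ θ)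
    {u : Vec d} (hu : u ≠ 0) : (1 - θ) / L ≤ b ∧ b ≤ 2 / μ := by
  have h0 := norm_pos_iff.2 hu
  have h1 : 0 < ‖u‖ ^ 2 := by positivity
  have hT : |⟪u, (ContinuousLinearMap.id ℝ (Vec d) - b • A) u⟫| ≤ θ * ‖u‖ ^ 2 := by
    refine (abs_real_inner_le_norm _ _).trans ?_
    have := ((ContinuousLinearMap.id ℝ (Vec d) - b • A).le_opNorm u).trans
      (mul_le_mul_of_nonneg_right hb h0.le)
    nlinarith
  have hA := h.lower u
  have hA' := h.upper u
  have e : ⟪u, (ContinuousLinearMap.id ℝ (Vec d) - b • A) u⟫ = ‖u‖ ^ 2 - b * ⟪u, A u⟫ := by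
    simp [inner_sub_right, real_inner_smul_right]
  rw [e, abs_le] at hT
  have hApos : 0 < ⟪u, A u⟫ := lt_of_lt_of_le (by positivity) hA
  have hbpos : 0 < b := by
    by_contra hb0
    have : b * ⟪u, A u⟫ ≤ 0 := mul_nonpos_of_nonpos_of_nonneg (not_lt.1 hb0) hApos.le
    nlinarith
  have hLpos : 0 < L := by
    by_contra hL0
    have : L * ‖u‖ ^ 2 ≤ 0 := mul_nonpos_of_nonpos_of_nonneg (not_lt.1 hL0) h1.le
    linarith
  have h2 : b * ⟪u, A u⟫ ≤ b * (L * ‖u‖ ^ 2) := mul_le_mul_of_nonneg_left hA' hbpos.le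
  have h3 : b * (μ * ‖u‖ ^ 2) ≤ b * ⟪u, A u⟫ := mul_le_mul_of_nonneg_left hA hbpos.le
  constructor
  · rw [div_le_iff₀ hLpos]
    refine le_of_mul_le_mul_right ?_ h1
    linarith
  · rw [le_div_iff₀ hμ]
    refine le_of_mul_le_mul_right ?_ h1
    nlinarith

open Polynomial in
lemma Elliptic.normN_aeval_le_of_Icc (h : Elliptic A μ L) (hμ : 0 < μ) (ty : AMType)
    (P : ℝ[X]) {M : ℝ} (hM : 0 ≤ M) (hP : ∀ t ∈ Set.Icc μ L, |P.eval t| ≤ M) (y : Vec d) :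
    normN ty A (aeval (A : Vec d →ₗ[ℝ] Vec d) P y) ≤ M * normN ty A y :=
  h.normN_aeval_le hμ ty P hM
    (fun t ht => hP t (eigenvalue_mem_Icc (A := (A : Vec d →ₗ[ℝ] Vec d)) h.lower h.upper ht)) y

open Polynomial in
-- Since `I - b A` is a polynomial in `A`, its Euclidean operator norm also bounds it in the energy
-- norm.
lemma Elliptic.normN_mix_le (h : Elliptic A μ L) (hμ : 0 < μ) (ty : AMType) (b : ℝ) (y : Vec d) :
    normN ty A (y - b • A y) ≤ mixNorm A b * normN ty A y := by
  have := h.normN_aeval_le hμ ty (1 - C b * X) (mixNorm_nonneg A b)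
    (fun t ht => by simpa [mixNorm] using abs_one_sub_mul_le_of_hasEigenvalue b t ht) y
  simpa using this

end Mix

/-! ### Rescaled runs between restarts and their comparison with the linear iteration. -/

/-- One step of a projection loop. -/
noncomputable def pairElim {d : ℕ} (v p q : Vec d) (ab : Vec d × Vec d) : Vec d × Vec d :=
  (ab.1 - (⟪v, ab.2⟫ / ⟪v, q⟫) • p, ab.2 - (⟪v, ab.2⟫ / ⟪v, q⟫) • q)

/-- The iterations of ST-AM between two restarts, shifted so that the solution is `0` and scaled
so that the first point has norm `1`. The indices count from the restart, with `p 0 = q 0 = 0`,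
and `ε` measures the deviation of the residual from the linear one. -/
structure Block (ty : AMType) (d J : ℕ) (τ μ L θ : ℝ) where
  A : Vec d →L[ℝ] Vec d
  elliptic : Elliptic A μ L
  β : ℕ → ℝ
  mix_le : ∀ j, mixNorm A (β j) ≤ θ
  x : ℕ → Vec d
  r : ℕ → Vec d
  p : ℕ → Vec d
  q : ℕ → Vec d
  y : ℕ → Vec d × Vec d
  ε : ℝ
  ρ : ℝ
  ε_pos : 0 < ε
  ρ_pos : 0 < ρ
  unit : ‖x 0‖ = 1
  residual : ∀ j ≤ J + 1, ‖x j‖ ≤ ρ → ‖r j + A (x j)‖ ≤ ε * ‖x j‖ ^ 2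
  p_zero : p 0 = 0
  q_zero : q 0 = 0
  pq_one : 1 ≤ J → (p 1, q 1) = (x 1 - x 0, r 1 - r 0)
  pq_succ : ∀ j, j + 2 ≤ J → (p (j + 2), q (j + 2)) =
    pairElim (dir ty p q (j + 1)) (p (j + 1)) (q (j + 1))
      (pairElim (dir ty p q j) (p j) (q j) (x (j + 2) - x (j + 1), r (j + 2) - r (j + 1)))
  y_zero : y 0 = (x 0, r 0)
  y_succ : ∀ j, j + 1 ≤ J → y (j + 1) =
    pairElim (dir ty p q (j + 1)) (p (j + 1)) (q (j + 1))
      (pairElim (dir ty p q j) (p j) (q j) (x (j + 1), r (j + 1)))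
  x_succ : ∀ j ≤ J, x (j + 1) = (y j).1 + β j • (y j).2
  no_restart : ∀ j, 1 ≤ j → j ≤ J →
    τ * |⟪dir ty p q 1, q 1⟫| ≤ |⟪dir ty p q j, q j⟫|

namespace Block

open Asymptotics Filter

variable {ty : AMType} {d J : ℕ} {τ μ L θ : ℝ}

/-- Blocks that start close to the solution. -/
noncomputable def nearSol (ty : AMType) (d J : ℕ) (τ μ L θ : ℝ) : Filter (Block ty d J τ μ L θ) :=
  comap (fun b => b.ε + 1 / b.ρ) (𝓝 0)

local notation "𝓑" => nearSol ty d J τ μ L θ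

lemma tendsto_ε : Tendsto (fun b : Block ty d J τ μ L θ => b.ε) 𝓑 (𝓝 0) := by
  refine squeeze_zero (fun b => b.ε_pos.le) (fun b => ?_) (tendsto_comap (x := 𝓝 (0 : ℝ)))
  have := one_div_pos.2 b.ρ_pos
  linarith

lemma eventually_le_ρ (R : ℝ) : ∀ᶠ b : Block ty d J τ μ L θ in 𝓑, R ≤ b.ρ := by
  have h1 : ∀ᶠ t : ℝ in 𝓝 0, t < 1 / (|R| + 1) := gt_mem_nhds (by positivity)
  filter_upwards [tendsto_comap.eventually h1] with b hb
  have h2 := b.ε_pos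
  have h3 : 1 / b.ρ < 1 / (|R| + 1) := by linarith
  have h4 := (one_div_lt_one_div b.ρ_pos (by positivity)).1 h3
  linarith [le_abs_self R]

lemma A_bdd (hL : 0 < L) : (fun b : Block ty d J τ μ L θ => b.A) =O[𝓑] (fun _ => (1 : ℝ)) := by
  refine IsBigO.of_bound L (Eventually.of_forall fun b => ?_)
  simpa using b.A.opNorm_le_bound hL.le b.elliptic.norm_upper

lemma x_zero_ne (b : Block ty d J τ μ L θ) : b.x 0 ≠ 0 := by
  intro h
  have := b.unit
  rw [h, norm_zero] at this
  exact zero_ne_one this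

lemma β_lower (b : Block ty d J τ μ L θ) (hμ : 0 < μ) (hθ : θ < 1) (j : ℕ) :
    (1 - θ) / L ≤ b.β j := (b.elliptic.mix_bounds hμ hθ (b.mix_le j) b.x_zero_ne).1

lemma β_upper (b : Block ty d J τ μ L θ) (hμ : 0 < μ) (hθ : θ < 1) (j : ℕ) :
    b.β j ≤ 2 / μ := (b.elliptic.mix_bounds hμ hθ (b.mix_le j) b.x_zero_ne).2

lemma β_pos (b : Block ty d J τ μ L θ) (hμ : 0 < μ) (hL : 0 < L) (hθ : θ < 1) (j : ℕ) :
    0 < b.β j := (div_pos (by linarith) hL).trans_le (b.β_lower hμ hθ j)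

lemma β_bdd (hμ : 0 < μ) (hL : 0 < L) (hθ : θ < 1) (j : ℕ) :
    (fun b : Block ty d J τ μ L θ => b.β j) =O[𝓑] (fun _ => (1 : ℝ)) := by
  refine IsBigO.of_bound (2 / μ) (Eventually.of_forall fun b => ?_)
  simpa [abs_of_pos (b.β_pos hμ hL hθ j)] using b.β_upper hμ hθ j

/-- The pair `(a, b)` agrees with `(a', -A a')` up to errors of order `ε`. -/
structure Track (a b a' : Block ty d J τ μ L θ → Vec d) : Prop where
  fst : Near 𝓑 (fun B => B.ε) a a'
  snd : Near 𝓑 (fun B => B.ε) b (fun B => -B.A (a' B))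

lemma Track.zero : Track (ty := ty) (J := J) (τ := τ) (μ := μ) (L := L) (θ := θ)
    (fun _ => (0 : Vec d)) (fun _ => 0) (fun _ => 0) :=
  ⟨Near.zero, Near.zero.congr (fun _ => rfl) fun _ => by simp⟩

lemma Track.sub {a b a' f g f' : Block ty d J τ μ L θ → Vec d} (h : Track a b a')
    (k : Track f g f') :
    Track (fun B => a B - f B) (fun B => b B - g B) (fun B => a' B - f' B) :=
  ⟨h.fst.sub k.fst, (h.snd.sub k.snd).congr (fun _ => rfl) fun B => by rw [map_sub]; abel⟩

/-- A family near a bounded one is eventually bounded by some `R`, and eventually `R ≤ ρ`, so the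
residual estimate applies with error at most `R² ε`. -/
lemma track_of_near (hL : 0 < L) {j : ℕ} (hj : j ≤ J + 1)
    {x' : Block ty d J τ μ L θ → Vec d} (h : Near 𝓑 (fun B => B.ε) (fun B => B.x j) x') :
    Track (fun B => B.x j) (fun B => B.r j) x' := by
  refine ⟨h, (h.apply (A_bdd hL)).neg.bdd, ?_⟩
  obtain ⟨R, hR⟩ := (h.bdd_left tendsto_ε).bound
  have h1 : (fun B : Block ty d J τ μ L θ => B.r j + B.A (B.x j)) =O[𝓑] (fun B => B.ε) := by
    refine IsBigO.of_bound (R ^ 2) ?_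
    filter_upwards [hR, eventually_le_ρ R] with B h2 h3
    rw [norm_one, mul_one] at h2
    refine (B.residual j hj (h2.trans h3)).trans ?_
    rw [Real.norm_eq_abs, abs_of_pos B.ε_pos, mul_comm]
    exact mul_le_mul_of_nonneg_right (pow_le_pow_left₀ (norm_nonneg _) h2 2) B.ε_pos.le
  refine (h1.sub (h.apply (A_bdd hL)).err).congr_left fun B => ?_
  abel

/-- The sign in front of the form in `v_i ⬝ b`. -/
noncomputable def dirSign : AMType → ℝ
  | .typeI => -1
  | .typeII => 1

lemma dirSign_ne_zero (ty : AMType) : dirSign ty ≠ 0 := by cases ty <;> simp [dirSign]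

/-- With `q` close to `-A p'`, Type-I gives minus the form of `A` and Type-II the form of `A ^ 2`;
the sign cancels in the quotients. -/
lemma Track.inner_dir {i : ℕ} {a b p' a' : Block ty d J τ μ L θ → Vec d}
    (hp : Track (fun B => B.p i) (fun B => B.q i) p') (h : Track a b a') :
    Near 𝓑 (fun B => B.ε) (fun B => ⟪dir ty B.p B.q i, b B⟫)
      (fun B => dirSign ty * formOf ty B.A (p' B) (a' B)) := by
  cases ty
  · refine (hp.fst.inner h.snd tendsto_ε).congr (fun B => rfl) fun B => ?_
    simp [dirSign, formOf_apply, opN]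
  · refine (hp.snd.inner h.snd tendsto_ε).congr (fun B => rfl) fun B => ?_
    simp [dirSign, formOf_apply, opN, B.elliptic.symm]

lemma Track.pairElim {i : ℕ} {a b p' a' : Block ty d J τ μ L θ → Vec d}
    (hp : Track (fun B => B.p i) (fun B => B.q i) p') (h : Track a b a')
    (hlow : i ≠ 0 → Away 𝓑 (fun B => ⟪dir ty B.p B.q i, B.q i⟫))
    (hz : i = 0 → ∀ B, p' B = 0) :
    Track (fun B => (pairElim (dir ty B.p B.q i) (B.p i) (B.q i) (a B, b B)).1)
      (fun B => (STAM.pairElim (dir ty B.p B.q i) (B.p i) (B.q i) (a B, b B)).2)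
      (fun B => elim (formOf ty B.A) (p' B) (a' B)) := by
  -- At index 0 the direction is zero in both iterations, so nothing is subtracted and no bound on a
  -- denominator is needed.
  rcases eq_or_ne i 0 with rfl | hi
  · refine ⟨h.fst.congr ?_ ?_, h.snd.congr ?_ ?_⟩ <;> intro B <;>
      simp [STAM.pairElim, elim, B.p_zero, B.q_zero, hz rfl B]
  · have hγ : Near 𝓑 (fun B => B.ε)
        (fun B => ⟪dir ty B.p B.q i, b B⟫ / ⟪dir ty B.p B.q i, B.q i⟫)
        (fun B => formOf ty B.A (p' B) (a' B) / formOf ty B.A (p' B) (p' B)) := by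
      refine ((hp.inner_dir h).div (hp.inner_dir hp) tendsto_ε (hlow hi)).congr
        (fun _ => rfl) fun B => ?_
      rw [mul_div_mul_left _ _ (dirSign_ne_zero ty)]
    refine ⟨h.fst.sub (hγ.smul hp.fst tendsto_ε), ?_⟩
    refine (h.snd.sub (hγ.smul hp.snd tendsto_ε)).congr (fun _ => rfl) fun B => ?_
    simp only [elim, map_sub, map_smul, smul_neg]
    abel

/-- The linear iteration that a block is compared with. -/
structure Model (x' y' p' : ℕ → Block ty d J τ μ L θ → Vec d) : Prop where
  start : ∀ B, x' 0 B = B.x 0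
  run : ∀ B, LinRun (formOf ty B.A) (B.A : Vec d →ₗ[ℝ] Vec d) B.β (fun j => x' j B)
    (fun j => y' j B) (fun j => p' j B)

lemma exists_model : ∃ x' y' p' : ℕ → Block ty d J τ μ L θ → Vec d, Model x' y' p' := by
  choose x y p h using fun B : Block ty d J τ μ L θ =>
    exists_linRun (formOf ty B.A) (B.A : Vec d →ₗ[ℝ] Vec d) B.β (B.x 0)
  exact ⟨fun j B => x B j, fun j B => y B j, fun j B => p B j, fun B => (h B).1, fun B => (h B).2⟩

namespace Model

variable {x' y' p' : ℕ → Block ty d J τ μ L θ → Vec d} (M : Model x' y' p')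
include M

lemma x_track_succ (hμ : 0 < μ) (hL : 0 < L) (hθ : θ < 1) {j : ℕ} (hj : j ≤ J)
    (hy : Track (fun B => (B.y j).1) (fun B => (B.y j).2) (y' j)) :
    Track (fun B => B.x (j + 1)) (fun B => B.r (j + 1)) (x' (j + 1)) := by
  refine track_of_near hL (by omega) ?_
  refine (hy.fst.add ((Near.refl (β_bdd hμ hL hθ j)).smul hy.snd tendsto_ε)).congr
    (fun B => (B.x_succ j hj).symm) fun B => ?_
  have := (M.run B).x_succ j
  rw [this, smul_neg, ← sub_eq_add_neg]
  rfl

lemma x_track_zero (hL : 0 < L) : Track (fun B => B.x 0) (fun B => B.r 0) (x' 0) := by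
  refine track_of_near hL (by omega) ?_
  refine (Near.refl ?_).congr (fun B => rfl) fun B => (M.start B).symm
  refine IsBigO.of_bound 1 (Eventually.of_forall fun B => ?_)
  simp [B.unit]

lemma y_track_zero (hL : 0 < L) : Track (fun B => (B.y 0).1) (fun B => (B.y 0).2) (y' 0) := by
  have h := M.x_track_zero hL
  refine ⟨h.fst.congr (fun B => by rw [B.y_zero]) fun B => (M.run B).y_zero.symm,
    h.snd.congr (fun B => by rw [B.y_zero]) fun B => ?_⟩
  have : y' 0 B = x' 0 B := (M.run B).y_zero
  rw [this]

lemma p_track_zero : Track (fun B => B.p 0) (fun B => B.q 0) (p' 0) := by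
  have h := Track.zero (ty := ty) (d := d) (J := J) (τ := τ) (μ := μ) (L := L) (θ := θ)
  have e : ∀ B, p' 0 B = 0 := fun B => (M.run B).p_zero
  exact ⟨h.fst.congr (fun B => B.p_zero.symm) fun B => (e B).symm,
    h.snd.congr (fun B => B.q_zero.symm) fun B => by rw [e]⟩

lemma p_track_one (hJ : 1 ≤ J) (hμ : 0 < μ) (hL : 0 < L) (hθ : θ < 1) :
    Track (fun B => B.p 1) (fun B => B.q 1) (p' 1) := by
  have h := (M.x_track_succ hμ hL hθ (by omega) (M.y_track_zero hL)).sub (M.x_track_zero hL)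
  have e : ∀ B, p' 1 B = x' 1 B - x' 0 B := fun B => (M.run B).p_one
  refine ⟨h.fst.congr (fun B => ?_) fun B => (e B).symm, h.snd.congr (fun B => ?_) fun B => ?_⟩
  · exact (congrArg Prod.fst (B.pq_one hJ)).symm
  · exact (congrArg Prod.snd (B.pq_one hJ)).symm
  · rw [e]

/-- The first model direction is `-β₀ A x₀` with `‖x₀‖ = 1`, so its norm is at least `(1 - θ) / L *
μ`; nearness passes the bound to the block. -/
lemma away_one (hJ : 1 ≤ J) (hμ : 0 < μ) (hL : 0 < L) (hθ : θ < 1) :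
    Away 𝓑 (fun B => ⟪dir ty B.p B.q 1, B.q 1⟫) := by
  have hp := M.p_track_one hJ hμ hL hθ
  refine ((hp.inner_dir hp).symm tendsto_ε).away tendsto_ε ?_
  have hc : 0 < min μ (μ ^ 2) := lt_min hμ (by positivity)
  have hb : 0 < (1 - θ) / L := div_pos (by linarith) hL
  refine ⟨min μ (μ ^ 2) * ((1 - θ) / L * μ) ^ 2, by positivity, Eventually.of_forall fun B => ?_⟩
  have e0 : y' 0 B = B.x 0 := (M.run B).y_zero.trans (M.start B)
  have e1 : p' 1 B = -(B.β 0 • B.A (B.x 0)) := by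
    have h1 : p' 1 B = x' 1 B - x' 0 B := (M.run B).p_one
    have h2 : x' 1 B = y' 0 B - B.β 0 • B.A (y' 0 B) := (M.run B).x_succ 0
    rw [h1, h2, M.start, e0]
    abel
  have h1 : (1 - θ) / L * μ ≤ ‖p' 1 B‖ := by
    rw [e1, norm_neg, norm_smul, Real.norm_eq_abs, abs_of_pos (B.β_pos hμ hL hθ 0)]
    have := B.elliptic.norm_lower (B.x 0)
    rw [B.unit, mul_one] at this
    exact mul_le_mul (B.β_lower hμ hθ 0) this hμ.le (B.β_pos hμ hL hθ 0).le
  have h2 := B.elliptic.formOf_self_lower hμ ty (p' 1 B)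
  have h3 : |dirSign ty| = 1 := by cases ty <;> simp [dirSign]
  rw [abs_mul, h3, one_mul]
  refine le_trans ?_ (le_abs_self _)
  refine le_trans ?_ h2
  exact mul_le_mul_of_nonneg_left (pow_le_pow_left₀ (by positivity) h1 2) hc.le

/-- The second restart test compares every denominator with the first one, which `away_one` bounds
below. -/
lemma away (hτ : 0 < τ) (hμ : 0 < μ) (hL : 0 < L) (hθ : θ < 1) {j : ℕ} (h1 : j ≠ 0)
    (hj : j ≤ J) : Away 𝓑 (fun B => ⟪dir ty B.p B.q j, B.q j⟫) := by
  obtain ⟨c, hc, hcf⟩ := M.away_one (by omega) hμ hL hθ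
  refine ⟨τ * c, by positivity, ?_⟩
  filter_upwards [hcf] with B hB
  exact (mul_le_mul_of_nonneg_left hB hτ.le).trans (B.no_restart j (by omega) hj)

lemma tracks (hτ : 0 < τ) (hμ : 0 < μ) (hL : 0 < L) (hθ : θ < 1) : ∀ j ≤ J,
    Track (fun B => B.x j) (fun B => B.r j) (x' j) ∧
    Track (fun B => B.p j) (fun B => B.q j) (p' j) ∧
    Track (fun B => (B.y j).1) (fun B => (B.y j).2) (y' j) := by
  intro j
  induction j using Nat.strong_induction_on with
  | _ j ih =>
  intro hj
  rcases j with _ | j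
  · exact ⟨M.x_track_zero hL, M.p_track_zero, M.y_track_zero hL⟩
  have hp0 : ∀ i : ℕ, i = 0 → ∀ B, p' i B = 0 := by
    rintro i rfl B
    exact (M.run B).p_zero
  obtain ⟨hxj, hpj, hyj⟩ := ih j (by omega) (by omega)
  have hx := M.x_track_succ hμ hL hθ (by omega) hyj
  have hp : Track (fun B => B.p (j + 1)) (fun B => B.q (j + 1)) (p' (j + 1)) := by
    rcases j with _ | j
    · exact M.p_track_one (by omega) hμ hL hθ
    have h1 := (ih j (by omega) (by omega)).2.1.pairElim (hx.sub hxj)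
      (fun h => M.away hτ hμ hL hθ h (by omega)) (hp0 _)
    have h2 := hpj.pairElim h1 (fun h => M.away hτ hμ hL hθ h (by omega)) (hp0 _)
    have e : ∀ B, p' (j + 2) B = elim (formOf ty B.A) (p' (j + 1) B)
      (elim (formOf ty B.A) (p' j B) (x' (j + 2) B - x' (j + 1) B)) := fun B =>
        (M.run B).p_succ j
    refine ⟨h2.fst.congr (fun B => ?_) fun B => (e B).symm,
      h2.snd.congr (fun B => ?_) fun B => by rw [e]⟩
    · exact (congrArg Prod.fst (B.pq_succ j (by omega))).symm
    · exact (congrArg Prod.snd (B.pq_succ j (by omega))).symm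
  refine ⟨hx, hp, ?_⟩
  have h1 := hpj.pairElim hx (fun h => M.away hτ hμ hL hθ h (by omega)) (hp0 _)
  have h2 := hp.pairElim h1 (fun h => M.away hτ hμ hL hθ h (by omega)) (hp0 _)
  have e : ∀ B, y' (j + 1) B = elim (formOf ty B.A) (p' (j + 1) B)
      (elim (formOf ty B.A) (p' j B) (x' (j + 1) B)) := fun B => (M.run B).y_succ j
  refine ⟨h2.fst.congr (fun B => ?_) fun B => (e B).symm,
    h2.snd.congr (fun B => ?_) fun B => by rw [e]⟩
  · exact (congrArg Prod.fst (B.y_succ j (by omega))).symm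
  · exact (congrArg Prod.snd (B.y_succ j (by omega))).symm

/-- This supplies the nonvanishing that the exact theory of `LinRun` assumes: a model denominator
near one bounded away from 0 is nonzero. -/
lemma eventually_p_ne (hτ : 0 < τ) (hμ : 0 < μ) (hL : 0 < L) (hθ : θ < 1) :
    ∀ᶠ B in 𝓑, ∀ i, 1 ≤ i → i ≤ J → p' i B ≠ 0 := by
  have h1 : ∀ᶠ B in 𝓑, ∀ i ∈ Finset.Icc 1 J, p' i B ≠ 0 := by
    rw [eventually_all_finset]
    intro i hi
    rw [Finset.mem_Icc] at hi
    have hp := (M.tracks hτ hμ hL hθ i hi.2).2.1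
    have := (hp.inner_dir hp).away tendsto_ε (M.away hτ hμ hL hθ (by omega) hi.2)
    filter_upwards [this.ne_zero] with B hB h0
    simp [h0] at hB
  filter_upwards [h1] with B hB i h2 h3
  exact hB i (Finset.mem_Icc.2 ⟨h2, h3⟩)

end Model

/-- Blocks that start close to the solution behave like the linear iteration, up to an error of
order `ε`. -/
theorem eventually_bounds (hτ : 0 < τ) (hμ : 0 < μ) (hL : 0 < L) (hμL : μ ≤ L) (hθ : θ < 1) :
    ∃ C > 0, ∃ s > 0, ∀ B : Block ty d J τ μ L θ, B.ε + 1 / B.ρ < s →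
      normN ty B.A (B.x (J + 1)) ≤ mixNorm B.A (B.β J) * normN ty B.A (B.x 0) + C * B.ε ∧
      normN ty B.A (B.x (J + 1)) ≤ mixNorm B.A (B.β J) * (2 * chebRate μ L ^ J) *
        normN ty B.A (B.x 0) + C * B.ε ∧
      (J = d → ‖B.x (J + 1)‖ ≤ C * B.ε) ∧
      ‖B.r 0 + B.A (B.x 0)‖ ≤ C * B.ε ∧ ‖B.r (J + 1) + B.A (B.x (J + 1))‖ ≤ C * B.ε := by
  obtain ⟨x', y', p', M⟩ := exists_model (ty := ty) (d := d) (J := J) (τ := τ) (μ := μ) (L := L)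
    (θ := θ)
  have hy := (M.tracks hτ hμ hL hθ J le_rfl).2.2
  have hx := M.x_track_succ hμ hL hθ le_rfl hy
  have hx0 := M.x_track_zero hL
  have hr : ∀ j, Track (fun B => B.x j) (fun B => B.r j) (x' j) →
      (fun B : Block ty d J τ μ L θ => B.r j + B.A (B.x j)) =O[𝓑] (fun B => B.ε) := by
    intro j h
    refine (h.snd.err.add (h.fst.apply (A_bdd hL)).err).congr_left fun B => ?_
    abel
  obtain ⟨C₁, hC₁⟩ := hx.fst.err.bound
  obtain ⟨C₂, hC₂⟩ := (hr 0 hx0).bound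
  obtain ⟨C₃, hC₃⟩ := (hr (J + 1) hx).bound
  set K := Real.sqrt (max L (L ^ 2)) with hK
  set C := max 1 (max (max C₁ (K * C₁)) (max C₂ C₃)) with hC
  have hCpos : 0 < C := lt_of_lt_of_le one_pos (le_max_left _ _)
  have hCC₁ : C₁ ≤ C := ((le_max_left _ _).trans (le_max_left _ _)).trans (le_max_right _ _)
  have hCKC₁ : K * C₁ ≤ C := ((le_max_right _ _).trans (le_max_left _ _)).trans (le_max_right _ _)
  have hCC₂ : C₂ ≤ C := ((le_max_left _ _).trans (le_max_right _ _)).trans (le_max_right _ _)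
  have hCC₃ : C₃ ≤ C := ((le_max_right _ _).trans (le_max_right _ _)).trans (le_max_right _ _)
  obtain ⟨P, hPd, hP0, hP⟩ := exists_chebyshev hμ hμL J
  have key : ∀ᶠ B : Block ty d J τ μ L θ in 𝓑,
      normN ty B.A (B.x (J + 1)) ≤ mixNorm B.A (B.β J) * normN ty B.A (B.x 0) + C * B.ε ∧
      normN ty B.A (B.x (J + 1)) ≤ mixNorm B.A (B.β J) * (2 * chebRate μ L ^ J) *
        normN ty B.A (B.x 0) + C * B.ε ∧
      (J = d → ‖B.x (J + 1)‖ ≤ C * B.ε) ∧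
      ‖B.r 0 + B.A (B.x 0)‖ ≤ C * B.ε ∧ ‖B.r (J + 1) + B.A (B.x (J + 1))‖ ≤ C * B.ε := by
    filter_upwards [hC₁, hC₂, hC₃, M.eventually_p_ne hτ hμ hL hθ] with B h1 h2 h3 hp
    rw [Real.norm_eq_abs, abs_of_pos B.ε_pos] at h1 h2 h3
    have hε := B.ε_pos.le
    have hB := B.elliptic.compatible hμ ty
    have hβ : ∀ i ≤ J, B.β i ≠ 0 := fun i _ => (B.β_pos hμ hL hθ i).ne'
    have hx' : x' (J + 1) B = y' J B - B.β J • B.A (y' J B) := (M.run B).x_succ J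
    have hmix := B.elliptic.normN_mix_le hμ ty (B.β J) (y' J B)
    rw [← hx'] at hmix
    have hpert : normN ty B.A (B.x (J + 1)) ≤
        mixNorm B.A (B.β J) * normN ty B.A (y' J B) + C * B.ε := by
      have e1 := B.elliptic.normN_add_le hμ ty (x' (J + 1) B) (B.x (J + 1) - x' (J + 1) B)
      rw [add_sub_cancel] at e1
      have e2 := B.elliptic.normN_upper ty (B.x (J + 1) - x' (J + 1) B)
      have e3 := mul_le_mul_of_nonneg_left h1 (Real.sqrt_nonneg (max L (L ^ 2)))
      have e4 := mul_le_mul_of_nonneg_right hCKC₁ hε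
      rw [← hK] at e2 e3
      linarith
    have hpoly : ∀ Q : Polynomial ℝ, Q.natDegree ≤ J → Q.coeff 0 = 1 → ∀ R, 0 ≤ R →
        (∀ t ∈ Set.Icc μ L, |Q.eval t| ≤ R) →
        normN ty B.A (y' J B) ≤ R * normN ty B.A (B.x 0) := by
      intro Q hQ hQ0 R hR hQR
      have e1 := (M.run B).form_y_le hB hβ hp Q hQ hQ0
      rw [M.start] at e1
      exact (Real.sqrt_le_sqrt e1).trans (B.elliptic.normN_aeval_le_of_Icc hμ ty Q hR hQR _)
    have hm0 := mixNorm_nonneg B.A (B.β J)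
    refine ⟨?_, ?_, ?_, ?_, ?_⟩
    -- The constant polynomial gives the factor 1, whereas the Chebyshev bound carries a 2 that
    -- would spoil the contraction argument.
    · have e1 := hpoly 1 (by simp) (by simp) 1 zero_le_one (by simp)
      rw [one_mul] at e1
      have e2 := mul_le_mul_of_nonneg_left e1 hm0
      linarith
    · have e1 := hpoly P hPd hP0 _ (mul_nonneg zero_le_two
        (pow_nonneg (chebRate_nonneg hμ hμL) J)) hP
      have e2 := mul_le_mul_of_nonneg_left e1 hm0
      linarith
    · intro hJ
      have e1 : y' J B = 0 := (M.run B).y_eq_zero hB hβ hp (by simp [hJ])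
      rw [hx', e1, map_zero, smul_zero, sub_zero, sub_zero] at h1
      exact h1.trans (mul_le_mul_of_nonneg_right hCC₁ hε)
    · exact h2.trans (mul_le_mul_of_nonneg_right hCC₂ hε)
    · exact h3.trans (mul_le_mul_of_nonneg_right hCC₃ hε)
  -- Unfolding the filter gives one threshold `s` valid for all blocks with these parameters.
  obtain ⟨t, ht, hts⟩ := mem_comap.1 key
  obtain ⟨s, hs, hst⟩ := Metric.mem_nhds_iff.1 ht
  refine ⟨C, hCpos, s, hs, fun B hB => hts (hst ?_)⟩
  have e1 := B.ε_pos
  have e2 := one_div_pos.2 B.ρ_pos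
  rw [Metric.mem_ball, Real.dist_eq, sub_zero, abs_of_pos (by positivity)]
  exact hB

end Block

variable {d : ℕ}

/-! ### One iteration of the algorithm. -/

section Step

variable (ty : AMType) (g : Vec d → Vec d) (mmax : ℕ) (τ η : ℝ) (β : ℕ → ℝ)

lemma step_m_succ (k : ℕ) (s : History d) :
    (step ty g mmax τ η β k s).m (k + 1) = (step ty g mmax τ η β k s).m k + 1 := by
  simp [step]

lemma step_x_of_le {k i : ℕ} (s : History d) (h : i ≤ k) :
    (step ty g mmax τ η β k s).x i = s.x i := by
  simp [step, Function.update_of_ne (by omega : i ≠ k + 1)]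

lemma step_p_of_ne {k i : ℕ} (s : History d) (h : i ≠ k) :
    (step ty g mmax τ η β k s).p i = s.p i := by
  simp only [step]
  split_ifs <;> simp [Function.update_of_ne h]

lemma step_q_of_ne {k i : ℕ} (s : History d) (h : i ≠ k) :
    (step ty g mmax τ η β k s).q i = s.q i := by
  simp only [step]
  split_ifs <;> simp [Function.update_of_ne h]

lemma step_x_succ (k : ℕ) (s t : History d) (ht : t = step ty g mmax τ η β k s) :
    ∃ ab : Vec d × Vec d, ab = sweep (dir ty t.p t.q) t.p t.q
      ((List.Ico (max 1 (t.m k - 1)) (t.m k + 1)).map (fun j => k - t.m k + j))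
      (s.x k, residual g (s.x k)) ∧ t.x (k + 1) = ab.1 + β k • ab.2 := by
  refine ⟨_, rfl, ?_⟩
  subst ht
  simp [step]

lemma step_memory (k : ℕ) (s t : History d) (ht : t = step ty g mmax τ η β k s) :
    t.m k = 0 ∨ (t.m k = s.m k ∧ s.m k ≤ mmax ∧
      (t.p k, t.q k) = sweep (dir ty s.p s.q) s.p s.q
        ((List.Ico (max 1 (t.m k - 2)) (t.m k)).map (fun j => k - t.m k + j))
        (s.x k - s.x (k - 1), residual g (s.x k) - residual g (s.x (k - 1))) ∧
      τ * |⟪dir ty t.p t.q (k - t.m k + 1), t.q (k - t.m k + 1)⟫| ≤ |⟪dir ty t.p t.q k, t.q k⟫|) := by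
  have hne : k ≠ k + 1 := by omega
  by_cases h1 : mmax < s.m k ∨ η * ‖residual g (s.x (k - s.m k))‖ < ‖residual g (s.x k)‖
  · left
    subst ht
    simp [step, h1]
  rcases Nat.eq_zero_or_pos (s.m k) with h0 | h0
  · left
    subst ht
    simp [step, h0]
  set pq := sweep (dir ty s.p s.q) s.p s.q
        ((List.Ico (max 1 (s.m k - 2)) (s.m k)).map (fun j => k - s.m k + j))
        (s.x k - s.x (k - 1), residual g (s.x k) - residual g (s.x (k - 1))) with hpq
  have hp : t.p = Function.update s.p k pq.1 := by
    subst ht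
    simp only [step, h1, if_false, h0, if_true, hpq]
  have hq : t.q = Function.update s.q k pq.2 := by
    subst ht
    simp only [step, h1, if_false, h0, if_true, hpq]
  have hm : t.m k = open Classical in
      if 0 < s.m k ∧ |⟪dir ty t.p t.q k, t.q k⟫| <
        τ * |⟪dir ty t.p t.q (k - s.m k + 1), t.q (k - s.m k + 1)⟫| then 0 else s.m k := by
    rw [hp, hq]
    subst ht
    simp only [step, h1, if_false, h0, if_true, hpq, Function.update_of_ne hne,
      Function.update_self]
  by_cases h2 : |⟪dir ty t.p t.q k, t.q k⟫| <
        τ * |⟪dir ty t.p t.q (k - s.m k + 1), t.q (k - s.m k + 1)⟫|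
  · left
    rw [hm, if_pos ⟨h0, h2⟩]
  · right
    rw [if_neg (fun h => h2 h.2)] at hm
    push Not at h1
    rw [hm]
    refine ⟨rfl, h1.1, ?_, not_lt.1 h2⟩
    rw [hp, hq, Function.update_self, Function.update_self]

end Step

lemma sweep_cons (v p q : ℕ → Vec d) (i : ℕ) (l : List ℕ) (ab : Vec d × Vec d) :
    sweep v p q (i :: l) ab = sweep v p q l (pairElim (v i) (p i) (q i) ab) := rfl

lemma sweep_congr {v p q v' p' q' : ℕ → Vec d} {l : List ℕ} (ab : Vec d × Vec d)
    (h : ∀ i ∈ l, v i = v' i ∧ p i = p' i ∧ q i = q' i) :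
    sweep v p q l ab = sweep v' p' q' l ab := by
  induction l generalizing ab with
  | nil => rfl
  | cons i l ih =>
    obtain ⟨h1, h2, h3⟩ := h i (by simp)
    rw [sweep_cons, sweep_cons, h1, h2, h3]
    exact ih _ fun j hj => h j (by simp [hj])

lemma dir_congr (ty : AMType) {p q p' q' : ℕ → Vec d} {i : ℕ} (hp : p i = p' i)
    (hq : q i = q' i) : dir ty p q i = dir ty p' q' i := by
  cases ty
  · exact hp
  · exact hq

/-! ### Recurrences along the whole run. -/

section Run

variable (ty : AMType) (g : Vec d → Vec d) (mmax : ℕ) (τ η : ℝ) (β : ℕ → ℝ) (x₀ : Vec d)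

local notation "𝓡" => run ty g mmax τ η β x₀
local notation "𝓧" => iterate ty g mmax τ η β x₀
local notation "𝓜" => memory ty g mmax τ η β x₀

/-- The vectors `p_k` produced by the algorithm. -/
noncomputable def stepDir (k : ℕ) : Vec d := (𝓡 (k + 1)).p k

/-- The vectors `q_k` produced by the algorithm. -/
noncomputable def stepRes (k : ℕ) : Vec d := (𝓡 (k + 1)).q k

local notation "𝓟" => stepDir ty g mmax τ η β x₀
local notation "𝓠" => stepRes ty g mmax τ η β x₀

lemma run_x {n i : ℕ} (h : i ≤ n) : (𝓡 n).x i = 𝓧 i := by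
  induction n, h using Nat.le_induction with
  | base => rfl
  | succ n hn ih => rw [← ih]; exact step_x_of_le _ _ _ _ _ _ _ hn

lemma run_p {n i : ℕ} (h : i + 1 ≤ n) : (𝓡 n).p i = 𝓟 i := by
  induction n, h using Nat.le_induction with
  | base => rfl
  | succ n hn ih => rw [← ih]; exact step_p_of_ne _ _ _ _ _ _ _ (by omega)

lemma run_q {n i : ℕ} (h : i + 1 ≤ n) : (𝓡 n).q i = 𝓠 i := by
  induction n, h using Nat.le_induction with
  | base => rfl
  | succ n hn ih => rw [← ih]; exact step_q_of_ne _ _ _ _ _ _ _ (by omega)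

lemma run_m_succ (k : ℕ) : (𝓡 (k + 1)).m (k + 1) = 𝓜 k + 1 := step_m_succ _ _ _ _ _ _ _ _

lemma memory_le_self (k : ℕ) : 𝓜 k ≤ k := by
  induction k with
  | zero =>
    rcases step_memory ty g mmax τ η β 0 (𝓡 0) _ rfl with h | h
    · exact h.le
    · exact h.1.le
  | succ k ih =>
    rcases step_memory ty g mmax τ η β (k + 1) (𝓡 (k + 1)) _ rfl with h | h
    · exact h.le.trans (Nat.zero_le _)
    · refine h.1.le.trans ?_
      rw [run_m_succ]
      omega

lemma memory_le (k : ℕ) : 𝓜 k ≤ mmax := by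
  rcases step_memory ty g mmax τ η β k (𝓡 k) _ rfl with h | h
  · exact h.le.trans (Nat.zero_le _)
  · exact h.1.le.trans h.2.1

lemma memory_succ (k : ℕ) (h : 𝓜 (k + 1) ≠ 0) : 𝓜 (k + 1) = 𝓜 k + 1 := by
  rcases step_memory ty g mmax τ η β (k + 1) (𝓡 (k + 1)) _ rfl with h1 | h1
  · exact absurd h1 h
  · rw [← run_m_succ]
    exact h1.1

/-- Memory grows by one unless it is reset, so the value `J` at `k₀ + J` places the last restart at
`k₀`. -/
lemma memory_of_block {k₀ J : ℕ} (h : 𝓜 (k₀ + J) = J) : ∀ j ≤ J, 𝓜 (k₀ + j) = j := by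
  induction J with
  | zero =>
    intro j hj
    obtain rfl : j = 0 := by omega
    exact h
  | succ J ih =>
    intro j hj
    rcases Nat.of_le_succ hj with h1 | rfl
    · refine ih ?_ j h1
      have := memory_succ ty g mmax τ η β x₀ (k₀ + J) (by rw [add_assoc, h]; omega)
      rw [add_assoc, h] at this
      omega
    · exact h

lemma iterate_succ (k : ℕ) : ∃ ab : Vec d × Vec d, ab = sweep (dir ty 𝓟 𝓠) 𝓟 𝓠
      ((List.Ico (max 1 (𝓜 k - 1)) (𝓜 k + 1)).map (fun j => k - 𝓜 k + j))
      (𝓧 k, residual g (𝓧 k)) ∧ 𝓧 (k + 1) = ab.1 + β k • ab.2 := by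
  obtain ⟨ab, hab, hx⟩ := step_x_succ ty g mmax τ η β k (𝓡 k) _ rfl
  refine ⟨ab, hab.trans ?_, hx⟩
  change sweep _ _ _ ((List.Ico (max 1 (𝓜 k - 1)) (𝓜 k + 1)).map (fun j => k - 𝓜 k + j)) _ = _
  have hle := memory_le_self ty g mmax τ η β x₀ k
  refine sweep_congr _ fun i hi => ?_
  obtain ⟨j, hj, rfl⟩ := List.mem_map.1 hi
  rw [List.Ico.mem] at hj
  have h1 := run_p ty g mmax τ η β x₀ (by omega : k - 𝓜 k + j + 1 ≤ k + 1)
  have h2 := run_q ty g mmax τ η β x₀ (by omega : k - 𝓜 k + j + 1 ≤ k + 1)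
  exact ⟨dir_congr ty h1 h2, h1, h2⟩

lemma memory_spec (k : ℕ) (h : 𝓜 k ≠ 0) :
    (𝓟 k, 𝓠 k) = sweep (dir ty 𝓟 𝓠) 𝓟 𝓠
        ((List.Ico (max 1 (𝓜 k - 2)) (𝓜 k)).map (fun j => k - 𝓜 k + j))
        (𝓧 k - 𝓧 (k - 1), residual g (𝓧 k) - residual g (𝓧 (k - 1))) ∧
      τ * |⟪dir ty 𝓟 𝓠 (k - 𝓜 k + 1), 𝓠 (k - 𝓜 k + 1)⟫| ≤ |⟪dir ty 𝓟 𝓠 k, 𝓠 k⟫| := by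
  have hle := memory_le_self ty g mmax τ η β x₀ k
  rcases step_memory ty g mmax τ η β k (𝓡 k) _ rfl with h1 | ⟨-, -, h1, h2⟩
  · exact absurd h1 h
  have e : ∀ i ≤ k, dir ty (𝓡 (k + 1)).p (𝓡 (k + 1)).q i = dir ty 𝓟 𝓠 i := fun i hi =>
    dir_congr ty (run_p ty g mmax τ η β x₀ (by omega)) (run_q ty g mmax τ η β x₀ (by omega))
  constructor
  · refine h1.trans ?_
    change sweep _ _ _ ((List.Ico (max 1 (𝓜 k - 2)) (𝓜 k)).map (fun j => k - 𝓜 k + j)) _ = _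
    rw [run_x ty g mmax τ η β x₀ le_rfl, run_x ty g mmax τ η β x₀ (Nat.sub_le k 1)]
    refine sweep_congr _ fun i hi => ?_
    obtain ⟨j, hj, rfl⟩ := List.mem_map.1 hi
    rw [List.Ico.mem] at hj
    have h1 := run_p ty g mmax τ η β x₀ (by omega : k - 𝓜 k + j + 1 ≤ k)
    have h2 := run_q ty g mmax τ η β x₀ (by omega : k - 𝓜 k + j + 1 ≤ k)
    exact ⟨dir_congr ty h1 h2, h1, h2⟩
  · change τ * |⟪dir ty (𝓡 (k + 1)).p (𝓡 (k + 1)).q (k - 𝓜 k + 1),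
      (𝓡 (k + 1)).q (k - 𝓜 k + 1)⟫| ≤ |⟪dir ty (𝓡 (k + 1)).p (𝓡 (k + 1)).q k, 𝓠 k⟫| at h2
    rwa [e _ (by omega), e _ le_rfl, run_q ty g mmax τ η β x₀ (by omega)] at h2

lemma sweep_snd_zero (v p q : ℕ → Vec d) (l : List ℕ) (a : Vec d) :
    sweep v p q l (a, 0) = (a, 0) := by
  induction l with
  | nil => rfl
  | cons i l ih =>
    rw [sweep_cons]
    simpa [pairElim] using ih

lemma iterate_succ_of_residual_eq_zero {k : ℕ} (h : residual g (𝓧 k) = 0) :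
    𝓧 (k + 1) = 𝓧 k := by
  obtain ⟨ab, hab, hx⟩ := iterate_succ ty g mmax τ η β x₀ k
  rw [h, sweep_snd_zero] at hab
  rw [hx, hab]
  simp

end Run

/-! ### Translation and scaling of the projection loops. -/

lemma pairElim_zero (v : Vec d) (ab : Vec d × Vec d) : pairElim v 0 0 ab = ab := by
  simp [pairElim]

lemma pairElim_sub (v p q s : Vec d) (ab : Vec d × Vec d) :
    pairElim v p q (ab - (s, 0)) = pairElim v p q ab - (s, 0) := by
  ext1
  · simp only [pairElim, Prod.fst_sub, Prod.snd_sub, sub_zero]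
    abel
  · simp only [pairElim, Prod.snd_sub, sub_zero]

/-- The projection coefficient is a quotient of two inner products that scale alike. -/
lemma pairElim_smul {c : ℝ} (hc : c ≠ 0) (v p q : Vec d) (ab : Vec d × Vec d) :
    pairElim (c • v) (c • p) (c • q) (c • ab) = c • pairElim v p q ab := by
  have h : ∀ u w : Vec d, ⟪c • v, c • u⟫ / ⟪c • v, c • w⟫ = ⟪v, u⟫ / ⟪v, w⟫ := by
    intro u w
    simp only [real_inner_smul_left, real_inner_smul_right, ← mul_assoc]
    rw [mul_div_mul_left _ _ (mul_ne_zero hc hc)]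
  ext1
  · simp only [pairElim, Prod.smul_fst, Prod.smul_snd, h]
    module
  · simp only [pairElim, Prod.smul_snd, h]
    module

/-- The sequence `u` shifted by `k₀`, scaled by `c`, and set to `0` at `0`. -/
noncomputable def rescale (c : ℝ) (k₀ : ℕ) (u : ℕ → Vec d) (j : ℕ) : Vec d :=
  -- The entry stored at the restart index itself may come from a direction rejected by the second
  -- test, and is discarded.
  if j = 0 then 0 else c • u (k₀ + j)

lemma dir_rescale (ty : AMType) (c : ℝ) (k₀ : ℕ) (p q : ℕ → Vec d) (j : ℕ) :
    dir ty (rescale c k₀ p) (rescale c k₀ q) j = rescale c k₀ (dir ty p q) j := by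
  cases ty <;> rfl

lemma pairElim_rescale {c : ℝ} (hc : c ≠ 0) (k₀ : ℕ) (v p q : ℕ → Vec d) (j : ℕ)
    (ab : Vec d × Vec d) :
    pairElim (rescale c k₀ v j) (rescale c k₀ p j) (rescale c k₀ q j) (c • ab) =
      c • (if j = 0 then ab else pairElim (v (k₀ + j)) (p (k₀ + j)) (q (k₀ + j)) ab) := by
  by_cases hj : j = 0
  · simp [rescale, hj, pairElim_zero]
  · simp only [rescale, hj, if_false]
    exact pairElim_smul hc _ _ _ _

/-- Both loops of the algorithm have this index range: `j + 2` is `m_k` for the directions and `m_k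
+ 1` for the projected point. -/
lemma sweep_dir_eq (v p q : ℕ → Vec d) (k₀ j : ℕ) (ab : Vec d × Vec d) :
    sweep v p q ((List.Ico (max 1 j) (j + 2)).map (fun i => k₀ + i)) ab =
      pairElim (v (k₀ + (j + 1))) (p (k₀ + (j + 1))) (q (k₀ + (j + 1)))
        (if j = 0 then ab else pairElim (v (k₀ + j)) (p (k₀ + j)) (q (k₀ + j)) ab) := by
  rcases j with _ | j
  · rw [max_eq_left (by omega), zero_add, List.Ico.eq_cons (by omega),
      List.Ico.eq_nil_of_le (by omega)]
    rfl
  · rw [max_eq_right (by omega), List.Ico.eq_cons (by omega), List.Ico.eq_cons (by omega),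
      List.Ico.eq_nil_of_le (by omega)]
    rfl

/-! ### From the algorithm to a block. -/

section Blocks

variable {ty : AMType} {g : Vec d → Vec d} {mmax : ℕ} {τ η : ℝ} {β : ℕ → ℝ} {x₀ : Vec d}
  {xs : Vec d} {A : Vec d →L[ℝ] Vec d} {μ L θ κ ρ : ℝ}

local notation "𝓧" => iterate ty g mmax τ η β x₀
local notation "𝓜" => memory ty g mmax τ η β x₀

/-- The iterations of the algorithm since the last restart form a block. -/
lemma exists_block (hA : Elliptic A μ L) (hmix : ∀ j, mixNorm A (β j) ≤ θ)
    (hκ : 0 < κ) (hρ : 0 < ρ)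
    (hres : ∀ x, ‖x - xs‖ ≤ ρ → ‖residual g x + A (x - xs)‖ ≤ κ * ‖x - xs‖ ^ 2)
    {k₀ J : ℕ} (hJ : 𝓜 (k₀ + J) = J) {e : ℝ} (he : ‖𝓧 k₀ - xs‖ = e) (he0 : 0 < e) :
    ∃ B : Block ty d J τ μ L θ, B.A = A ∧ B.ε = κ * e ∧ B.ρ = ρ / e ∧ B.β J = β (k₀ + J) ∧
      (∀ j, B.x j = e⁻¹ • (𝓧 (k₀ + j) - xs)) ∧ ∀ j, B.r j = e⁻¹ • residual g (𝓧 (k₀ + j)) := by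
  have hmem := memory_of_block ty g mmax τ η β x₀ hJ
  have hei : e⁻¹ ≠ 0 := inv_ne_zero he0.ne'
  set P := stepDir ty g mmax τ η β x₀ with hP
  set Q := stepRes ty g mmax τ η β x₀ with hQ
  have hpq : ∀ j, 1 ≤ j → j ≤ J → (P (k₀ + j), Q (k₀ + j)) =
      sweep (dir ty P Q) P Q ((List.Ico (max 1 (j - 2)) j).map (fun i => k₀ + i))
        (𝓧 (k₀ + j) - 𝓧 (k₀ + j - 1), residual g (𝓧 (k₀ + j)) - residual g (𝓧 (k₀ + j - 1))) ∧
      τ * |⟪dir ty P Q (k₀ + 1), Q (k₀ + 1)⟫| ≤ |⟪dir ty P Q (k₀ + j), Q (k₀ + j)⟫| := by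
    intro j h1 h2
    have h3 := hmem j h2
    have h4 := memory_spec ty g mmax τ η β x₀ (k₀ + j) (by omega)
    rw [h3, Nat.add_sub_cancel] at h4
    exact h4
  have hx : ∀ j ≤ J, ∃ ab, ab = sweep (dir ty P Q) P Q
      ((List.Ico (max 1 (j - 1)) (j + 1)).map (fun i => k₀ + i))
      (𝓧 (k₀ + j), residual g (𝓧 (k₀ + j))) ∧ 𝓧 (k₀ + j + 1) = ab.1 + β (k₀ + j) • ab.2 := by
    intro j h2
    have h4 := iterate_succ ty g mmax τ η β x₀ (k₀ + j)
    rw [hmem j h2, Nat.add_sub_cancel] at h4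
    exact h4
  have hpairs : ∀ j, 1 ≤ j → j ≤ J →
      (rescale e⁻¹ k₀ P j, rescale e⁻¹ k₀ Q j) = e⁻¹ • (P (k₀ + j), Q (k₀ + j)) := by
    intro j h1 _
    have hj0 : ¬j = 0 := by omega
    simp [rescale, hj0]
  have hdiff : ∀ a b c f : Vec d, (e⁻¹ • (a - xs) - e⁻¹ • (b - xs), e⁻¹ • c - e⁻¹ • f) =
      e⁻¹ • (a - b, c - f) := by
    intro a b c f
    rw [← smul_sub, ← smul_sub, sub_sub_sub_cancel_right]
    rfl
  refine ⟨{ A := A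
            elliptic := hA
            β := fun j => β (k₀ + j)
            mix_le := fun j => hmix _
            x := fun j => e⁻¹ • (𝓧 (k₀ + j) - xs)
            r := fun j => e⁻¹ • residual g (𝓧 (k₀ + j))
            p := rescale e⁻¹ k₀ P
            q := rescale e⁻¹ k₀ Q
            y := fun j => match j with
              | 0 => (e⁻¹ • (𝓧 k₀ - xs), e⁻¹ • residual g (𝓧 k₀))
              | j + 1 => pairElim (dir ty (rescale e⁻¹ k₀ P) (rescale e⁻¹ k₀ Q) (j + 1))
                  (rescale e⁻¹ k₀ P (j + 1)) (rescale e⁻¹ k₀ Q (j + 1))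
                  (pairElim (dir ty (rescale e⁻¹ k₀ P) (rescale e⁻¹ k₀ Q) j)
                    (rescale e⁻¹ k₀ P j) (rescale e⁻¹ k₀ Q j)
                    (e⁻¹ • (𝓧 (k₀ + (j + 1)) - xs), e⁻¹ • residual g (𝓧 (k₀ + (j + 1)))))
            ε := κ * e
            ρ := ρ / e
            ε_pos := by positivity
            ρ_pos := by positivity
            unit := ?_
            residual := ?_
            p_zero := by simp [rescale]
            q_zero := by simp [rescale]
            pq_one := ?_
            pq_succ := ?_
            y_zero := rfl
            y_succ := fun _ _ => rfl
            x_succ := ?_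
            no_restart := ?_ }, rfl, rfl, rfl, rfl, fun j => rfl, fun j => rfl⟩
  · rw [add_zero, norm_smul, he, norm_inv, Real.norm_eq_abs, abs_of_pos he0, inv_mul_cancel₀ he0.ne']
  · intro j hj hxj
    rw [norm_smul, norm_inv, Real.norm_eq_abs, abs_of_pos he0, ← div_eq_inv_mul,
      div_le_div_iff_of_pos_right he0] at hxj
    rw [map_smul, ← smul_add, norm_smul, norm_smul, norm_inv, Real.norm_eq_abs, abs_of_pos he0]
    refine (mul_le_mul_of_nonneg_left (hres _ hxj) (inv_pos.2 he0).le).trans (le_of_eq ?_)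
    field_simp
  · intro h1
    have h2 := (hpq 1 le_rfl h1).1
    rw [hpairs 1 le_rfl h1, h2, add_zero, hdiff, Nat.add_sub_cancel]
    rw [List.Ico.eq_nil_of_le (by omega)]
    rfl
  · intro j hj
    have h2 := (hpq (j + 2) (by omega) hj).1
    rw [hpairs (j + 2) (by omega) hj, h2, hdiff, dir_rescale, dir_rescale, pairElim_rescale hei,
      pairElim_rescale hei, Nat.add_sub_cancel, sweep_dir_eq, if_neg (Nat.succ_ne_zero j)]
    rfl
  · intro j hj
    obtain ⟨ab, hab, hxj⟩ := hx j hj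
    rcases j with _ | j
    · rw [List.Ico.eq_nil_of_le (by omega)] at hab
      obtain rfl : ab = (𝓧 k₀, residual g (𝓧 k₀)) := hab
      change e⁻¹ • (𝓧 (k₀ + 1) - xs) = e⁻¹ • (𝓧 k₀ - xs) + β k₀ • e⁻¹ • residual g (𝓧 k₀)
      have hxj' : 𝓧 (k₀ + 1) = 𝓧 k₀ + β k₀ • residual g (𝓧 k₀) := hxj
      rw [hxj']
      module
    · rw [Nat.add_sub_cancel, sweep_dir_eq] at hab
      have hsm : ((e⁻¹ • (𝓧 (k₀ + (j + 1)) - xs), e⁻¹ • residual g (𝓧 (k₀ + (j + 1)))) :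
          Vec d × Vec d) = e⁻¹ • ((𝓧 (k₀ + (j + 1)), residual g (𝓧 (k₀ + (j + 1)))) - (xs, 0)) := by
        ext1 <;> simp
      simp only
      rw [hsm, dir_rescale, dir_rescale, pairElim_rescale hei, pairElim_rescale hei,
        if_neg (Nat.succ_ne_zero j)]
      -- Translation by `xs` affects only the first component, while the coefficients come from the
      -- second, so it passes through the loop.
      have hshift : ∀ u w : Vec d × Vec d, (if j = 0 then u - (xs, 0) else
          pairElim (dir ty P Q (k₀ + j)) (P (k₀ + j)) (Q (k₀ + j)) (u - (xs, 0))) =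
          (if j = 0 then u else
          pairElim (dir ty P Q (k₀ + j)) (P (k₀ + j)) (Q (k₀ + j)) u) - (xs, 0) := by
        intro u _
        split_ifs
        · rfl
        · exact pairElim_sub _ _ _ _ _
      rw [hshift _ 0, pairElim_sub, ← hab]
      change e⁻¹ • (𝓧 (k₀ + (j + 1) + 1) - xs) =
        e⁻¹ • (ab.1 - xs) + β (k₀ + (j + 1)) • e⁻¹ • (ab.2 - 0)
      rw [hxj]
      module
  · intro j h1 h2
    have h3 := (hpq j h1 h2).2
    rw [dir_rescale, dir_rescale]
    have hj0 : ¬j = 0 := by omega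
    simp only [rescale, one_ne_zero, if_false, hj0, real_inner_smul_left,
      real_inner_smul_right, abs_mul]
    have h4 : 0 ≤ |e⁻¹| * |e⁻¹| := by positivity
    have := mul_le_mul_of_nonneg_left h3 h4
    linarith

end Blocks

/-- The bounds for a block hold with constant `K` once `ε + 1 / ρ < 1 / K`. -/
def BlockBounds (ty : AMType) (d J : ℕ) (τ μ L θ K : ℝ) : Prop :=
  ∀ B : Block ty d J τ μ L θ, B.ε + 1 / B.ρ < 1 / K →
    normN ty B.A (B.x (J + 1)) ≤ mixNorm B.A (B.β J) * normN ty B.A (B.x 0) + K * B.ε ∧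
    normN ty B.A (B.x (J + 1)) ≤ mixNorm B.A (B.β J) * (2 * chebRate μ L ^ J) *
      normN ty B.A (B.x 0) + K * B.ε ∧
    (J = d → ‖B.x (J + 1)‖ ≤ K * B.ε) ∧
    ‖B.r 0 + B.A (B.x 0)‖ ≤ K * B.ε ∧ ‖B.r (J + 1) + B.A (B.x (J + 1))‖ ≤ K * B.ε

lemma exists_blockBounds {τ μ L θ : ℝ} (hτ : 0 < τ) (hμ : 0 < μ) (hL : 0 < L) (hμL : μ ≤ L)
    (hθ : θ < 1) (m : ℕ) : ∃ K > 0, ∀ ty, ∀ J ≤ m, BlockBounds ty d J τ μ L θ K := by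
  have key : ∀ ty J, ∀ᶠ K in Filter.atTop, BlockBounds ty d J τ μ L θ K := by
    intro ty J
    obtain ⟨C, hC, s, hs, h⟩ := Block.eventually_bounds (ty := ty) (d := d) (J := J) hτ hμ hL hμL hθ
    filter_upwards [Filter.eventually_ge_atTop C, Filter.eventually_ge_atTop (1 / s)] with K h1 h2 B hB
    have hK : 0 < K := hC.trans_le h1
    obtain ⟨b1, b2, b3, b4, b5⟩ := h B (hB.trans_le ((one_div_le hs hK).1 h2))
    have h3 := mul_le_mul_of_nonneg_right h1 B.ε_pos.le
    exact ⟨b1.trans (by linarith), b2.trans (by linarith), fun hJ => (b3 hJ).trans h3,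
      b4.trans h3, b5.trans h3⟩
  have all : ∀ ty, ∀ᶠ K in Filter.atTop, ∀ J ∈ Finset.range (m + 1),
      BlockBounds ty d J τ μ L θ K := fun ty =>
    (Filter.eventually_all_finset _).2 fun J _ => key ty J
  obtain ⟨K, h1, h2, h3⟩ := ((Filter.eventually_gt_atTop (0 : ℝ)).and
    ((all .typeI).and (all .typeII))).exists
  refine ⟨K, h1, fun ty J hJ => ?_⟩
  cases ty
  · exact h2 J (by simpa using Nat.lt_succ_of_le hJ)
  · exact h3 J (by simpa using Nat.lt_succ_of_le hJ)

/-! ### Estimates for the iterates, and stability of restarts. -/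

section Global

variable {ty : AMType} {g : Vec d → Vec d} {mmax : ℕ} {τ η : ℝ} {β : ℕ → ℝ} {x₀ : Vec d}
  {xs : Vec d} {A : Vec d →L[ℝ] Vec d} {μ L θ κ ρ K : ℝ}

local notation "𝓧" => iterate ty g mmax τ η β x₀
local notation "𝓜" => memory ty g mmax τ η β x₀

/-- The estimates for one iteration whose last restart was close to the solution. -/
lemma iterate_bounds (hK : 0 < K) (hB : ∀ J ≤ mmax, BlockBounds ty d J τ μ L θ K)
    (hA : Elliptic A μ L) (hmix : ∀ j, mixNorm A (β j) ≤ θ)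
    (hκ : 0 < κ) (hρ : 0 < ρ)
    (hres : ∀ x, ‖x - xs‖ ≤ ρ → ‖residual g x + A (x - xs)‖ ≤ κ * ‖x - xs‖ ^ 2) (k : ℕ)
    (hsmall : (κ + 1 / ρ) * ‖𝓧 (k - 𝓜 k) - xs‖ < 1 / K) :
    normN ty A (𝓧 (k + 1) - xs) ≤ mixNorm A (β k) * normN ty A (𝓧 (k - 𝓜 k) - xs) +
        K * κ * ‖𝓧 (k - 𝓜 k) - xs‖ ^ 2 ∧
    normN ty A (𝓧 (k + 1) - xs) ≤ mixNorm A (β k) * (2 * chebRate μ L ^ 𝓜 k) *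
        normN ty A (𝓧 (k - 𝓜 k) - xs) + K * κ * ‖𝓧 (k - 𝓜 k) - xs‖ ^ 2 ∧
    (𝓜 k = d → ‖𝓧 (k + 1) - xs‖ ≤ K * κ * ‖𝓧 (k - 𝓜 k) - xs‖ ^ 2) ∧
    ‖residual g (𝓧 (k - 𝓜 k)) + A (𝓧 (k - 𝓜 k) - xs)‖ ≤
      K * κ * ‖𝓧 (k - 𝓜 k) - xs‖ ^ 2 ∧
    ‖residual g (𝓧 (k + 1)) + A (𝓧 (k + 1) - xs)‖ ≤ K * κ * ‖𝓧 (k - 𝓜 k) - xs‖ ^ 2 := by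
  have hle := memory_le_self ty g mmax τ η β x₀ k
  have hJm := memory_le ty g mmax τ η β x₀ k
  obtain ⟨J, hJ⟩ : ∃ J, 𝓜 k = J := ⟨_, rfl⟩
  obtain ⟨k₀, rfl⟩ : ∃ k₀, k = k₀ + J := ⟨k - J, by omega⟩
  rw [hJ] at hsmall hJm ⊢
  rw [Nat.add_sub_cancel] at hsmall ⊢
  obtain ⟨e, he⟩ : ∃ e, ‖𝓧 k₀ - xs‖ = e := ⟨_, rfl⟩
  -- A restart exactly at the solution cannot be rescaled, but then the iterates stay there.
  rcases (norm_nonneg (𝓧 k₀ - xs)).eq_or_lt with h0 | h0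
  · have hz : 𝓧 k₀ - xs = 0 := norm_eq_zero.1 h0.symm
    have hr0 : residual g xs = 0 := by
      have := hres xs (by simpa using hρ.le)
      simpa using this
    have hconst : ∀ j, 𝓧 (k₀ + j) = xs := by
      intro j
      induction j with
      | zero => exact sub_eq_zero.1 hz
      | succ j ih =>
        rw [← add_assoc, iterate_succ_of_residual_eq_zero, ih]
        rw [ih, hr0]
    have h1 := hconst (J + 1)
    rw [← add_assoc] at h1
    have h2 := hconst 0
    rw [add_zero] at h2
    simp [h1, h2, hr0, normN]
  rw [he] at h0 hsmall ⊢
  obtain ⟨B, hBA, hBε, hBρ, hBβ, hBx, hBr⟩ := exists_block (μ := μ) (L := L) hA hmix hκ hρ hres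
    hJ he h0
  have hcond : B.ε + 1 / B.ρ < 1 / K := by
    rw [hBε, hBρ]
    refine lt_of_eq_of_lt ?_ hsmall
    field_simp
  obtain ⟨b1, b2, b3, b4, b5⟩ := hB J hJm B hcond
  have hei : |e⁻¹| = e⁻¹ := abs_of_pos (inv_pos.2 h0)
  have hnorm : ‖e⁻¹‖ = e⁻¹ := hei
  simp only [hBx, hBr, hBA, hBε, hBβ, add_zero, normN_smul, hei, map_smul, ← smul_add, norm_smul,
    hnorm] at b1 b2 b3 b4 b5
  have hmul : ∀ a c : ℝ, e⁻¹ * a ≤ c → a ≤ e * c := by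
    intro a c h
    have := mul_le_mul_of_nonneg_left h h0.le
    rwa [← mul_assoc, mul_inv_cancel₀ h0.ne', one_mul] at this
  have hee : e * e⁻¹ = 1 := mul_inv_cancel₀ h0.ne'
  refine ⟨(hmul _ _ b1).trans (le_of_eq ?_), (hmul _ _ b2).trans (le_of_eq ?_),
    fun hJd => (hmul _ _ (b3 hJd)).trans (le_of_eq ?_), (hmul _ _ b4).trans (le_of_eq ?_),
    (hmul _ _ b5).trans (le_of_eq ?_)⟩
  all_goals field_simp

/-- If the initial point is close to the solution, then all restarts are. -/
lemma normN_iterate_le (hK : 0 < K) (hB : ∀ J ≤ mmax, BlockBounds ty d J τ μ L θ K)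
    (hA : Elliptic A μ L) (hμ : 0 < μ) (hmix : ∀ j, mixNorm A (β j) ≤ θ)
    (hκ : 0 < κ) (hρ : 0 < ρ)
    (hres : ∀ x, ‖x - xs‖ ≤ ρ → ‖residual g x + A (x - xs)‖ ≤ κ * ‖x - xs‖ ^ 2) {R : ℝ}
    (hR : (κ + 1 / ρ) * R < 1 / K)
    (hR' : K * κ * R ≤ (1 - θ) * Real.sqrt (min μ (μ ^ 2)))
    (hx₀ : normN ty A (x₀ - xs) ≤ Real.sqrt (min μ (μ ^ 2)) * R) (k : ℕ) :
    normN ty A (𝓧 k - xs) ≤ Real.sqrt (min μ (μ ^ 2)) * R := by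
  have ha : 0 < Real.sqrt (min μ (μ ^ 2)) := Real.sqrt_pos.2 (lt_min hμ (by positivity))
  induction k using Nat.strong_induction_on with
  | _ k ih =>
  rcases k with _ | k
  · exact hx₀
  have h1 := ih (k - 𝓜 k) (by omega)
  have h2 := hA.normN_lower hμ ty (𝓧 (k - 𝓜 k) - xs)
  have h3 : ‖𝓧 (k - 𝓜 k) - xs‖ ≤ R := le_of_mul_le_mul_left (h2.trans h1) ha
  have h4 : (κ + 1 / ρ) * ‖𝓧 (k - 𝓜 k) - xs‖ < 1 / K :=
    (mul_le_mul_of_nonneg_left h3 (by positivity)).trans_lt hR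
  refine ((iterate_bounds hK hB hA hmix hκ hρ hres k h4).1.trans ?_).trans h1
  have h5 := mul_le_mul_of_nonneg_right (hmix k) (normN_nonneg ty A (𝓧 (k - 𝓜 k) - xs))
  have hθ : 0 ≤ 1 - θ := by
    by_contra hneg
    have : (1 - θ) * Real.sqrt (min μ (μ ^ 2)) < 0 := mul_neg_of_neg_of_pos (not_le.1 hneg) ha
    have : 0 ≤ K * κ * R := mul_nonneg (by positivity) ((norm_nonneg _).trans h3)
    linarith
  -- One factor of the squared distance is at most `R`, and `hR'` makes the quadratic term fit into
  -- the gap `1 - θ`.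
  have h6 : K * κ * ‖𝓧 (k - 𝓜 k) - xs‖ ^ 2 ≤ (1 - θ) * normN ty A (𝓧 (k - 𝓜 k) - xs) := by
    calc K * κ * ‖𝓧 (k - 𝓜 k) - xs‖ ^ 2 = K * κ * ‖𝓧 (k - 𝓜 k) - xs‖ * ‖𝓧 (k - 𝓜 k) - xs‖ := by ring
      _ ≤ K * κ * R * ‖𝓧 (k - 𝓜 k) - xs‖ := by gcongr
      _ ≤ (1 - θ) * Real.sqrt (min μ (μ ^ 2)) * ‖𝓧 (k - 𝓜 k) - xs‖ := by gcongr
      _ = (1 - θ) * (Real.sqrt (min μ (μ ^ 2)) * ‖𝓧 (k - 𝓜 k) - xs‖) := by ring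
      _ ≤ _ := mul_le_mul_of_nonneg_left h2 hθ
  linarith

end Global

lemma chebRate_le_one {μ L : ℝ} : chebRate μ L ≤ 1 := by
  have := Real.sqrt_nonneg (L / μ)
  unfold chebRate
  rw [div_le_one (by linarith)]
  linarith

/-! ### Consequences of the assumptions on `g`. -/

section Setting

variable {g : Vec d → Vec d} {xs : Vec d} {ρ κ μ L : ℝ}

lemma fderiv_sub_eq_opA (h : RegularZero (fun x => x - g x) xs) :
    fderiv ℝ (fun x => x - g x) xs = opA g xs := by
  obtain ⟨U, hU, hd, -⟩ := h.lipschitz_deriv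
  have h1 := hd xs (mem_of_mem_nhds hU)
  have hg : DifferentiableAt ℝ g xs := by
    have h2 := differentiableAt_id.sub h1
    have h3 : (id - fun x => x - g x) = g := by
      funext x
      simp
    rwa [h3] at h2
  rw [fderiv_fun_sub differentiableAt_fun_id hg, fderiv_fun_id]
  rfl

lemma elliptic_opA (hρ : 0 < ρ) (h : RegularZero (fun x => x - g x) xs)
    (hs : ∀ᶠ x in 𝓝 xs, (fderiv ℝ g x : Vec d →ₗ[ℝ] Vec d).IsSymmetric)
    (hc : LocalConstants (fun x => x - g x) xs ρ κ μ L) : Elliptic (opA g xs) μ L := by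
  have hxs : xs ∈ Metric.closedBall xs ρ := Metric.mem_closedBall_self hρ.le
  have e := fderiv_sub_eq_opA h
  refine ⟨fun u v => ?_, fun y => ?_, fun y => ?_, fun y => ?_⟩
  · have h1 : ⟪fderiv ℝ g xs u, v⟫ = ⟪u, fderiv ℝ g xs v⟫ := hs.self_of_nhds u v
    simp [opA, inner_sub_left, inner_sub_right, h1]
  · rw [← e]; exact hc.form_lower xs hxs y
  · rw [← e]; exact hc.form_upper xs hxs y
  · rw [← e]; exact hc.norm_upper xs hxs y

lemma norm_residual_add_le (hκ : 0 < κ) (h : RegularZero (fun x => x - g x) xs)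
    (hc : LocalConstants (fun x => x - g x) xs ρ κ μ L) (x : Vec d) (hx : ‖x - xs‖ ≤ ρ) :
    ‖residual g x + opA g xs (x - xs)‖ ≤ κ * ‖x - xs‖ ^ 2 := by
  have h1 := hc.linear_error x (by rwa [Metric.mem_closedBall, dist_eq_norm])
  rw [fderiv_sub_eq_opA h, ← norm_neg] at h1
  have h2 : -((fun x => x - g x) x - opA g xs (x - xs)) = residual g x + opA g xs (x - xs) := by
    simp only [residual]
    abel
  rw [h2] at h1
  have := mul_nonneg hκ.le (sq_nonneg ‖x - xs‖)
  linarith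

lemma Elliptic.le [NeZero d] {A : Vec d →L[ℝ] Vec d} (h : Elliptic A μ L) : μ ≤ L := by
  have h1 := (h.lower (EuclideanSpace.single 0 1)).trans (h.upper (EuclideanSpace.single 0 1))
  simpa using h1

end Setting

end STAM

/-! ### Assembly of the theorem. -/

open STAM in
theorem theorem6p1 (d m : ℕ) (hm : 0 < m) (hmd : m ≤ d)
    (τ η μ L θ : ℝ) (hτ₀ : 0 < τ) (hτ₁ : τ < 1) (hη : 0 < η) (hμ : 0 < μ) (hL : 0 < L)
    (hθ₀ : (L - μ) / (L + μ) ≤ θ) (hθ₁ : θ < 1) :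
    ∃ C : ℝ, 0 < C ∧
      ∀ (g : STAM.Vec d → STAM.Vec d) (xs : STAM.Vec d) (ρ κ : ℝ), 0 < ρ → 0 < κ →
        STAM.RegularZero (fun x => x - g x) xs →
        (∀ᶠ x in 𝓝 xs, (fderiv ℝ g x : STAM.Vec d →ₗ[ℝ] STAM.Vec d).IsSymmetric) →
        STAM.LocalConstants (fun x => x - g x) xs ρ κ μ L →
        ∃ δ : ℝ, 0 < δ ∧ ∀ x₀ : STAM.Vec d, ‖x₀ - xs‖ ≤ δ →
          ∀ β : ℕ → ℝ, (∀ k, STAM.mixNorm (STAM.opA g xs) (β k) ≤ θ) →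
            -- Type-I: contraction of the error in the A-norm
            (∀ k : ℕ,
              let x := STAM.iterate .typeI g m τ η β x₀
              let mk := STAM.memory .typeI g m τ η β x₀ k
              STAM.normA (STAM.opA g xs) (x (k + 1) - xs) ≤
                2 * STAM.mixNorm (STAM.opA g xs) (β k) * STAM.chebRate μ L ^ mk *
                    STAM.normA (STAM.opA g xs) (x (k - mk) - xs) +
                  κ * (C * ‖x (k - mk) - xs‖ ^ 2)) ∧
            -- Type-II: contraction of the residual
            (∀ k : ℕ,
              let x := STAM.iterate .typeII g m τ η β x₀
              let mk := STAM.memory .typeII g m τ η β x₀ k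
              ‖STAM.residual g (x (k + 1))‖ ≤
                2 * STAM.mixNorm (STAM.opA g xs) (β k) * STAM.chebRate μ L ^ mk *
                    ‖STAM.residual g (x (k - mk))‖ +
                  κ * (C * ‖x (k - mk) - xs‖ ^ 2)) ∧
            -- both types: (d+1)-step quadratic convergence
            (∀ (ty : AMType) (k : ℕ),
              let x := STAM.iterate ty g m τ η β x₀
              let mk := STAM.memory ty g m τ η β x₀ k
              mk = d → ‖x (k + 1) - xs‖ ≤ κ * (C * ‖x (k - mk) - xs‖ ^ 2)) := by
  have : NeZero d := ⟨by omega⟩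
  by_cases hμL : μ ≤ L
  swap
  -- If `L < μ`, the bounds on the quadratic form contradict each other, as `d > 0`.
  · exact ⟨1, one_pos, fun g xs ρ κ hρ _ h hs hc => absurd (elliptic_opA hρ h hs hc).le hμL⟩
  obtain ⟨K, hK, hB⟩ := exists_blockBounds (d := d) hτ₀ hμ hL hμL hθ₁ m
  -- Type-II needs `4 * K`: one `K` from the block, one from passing to the residual at `x (k + 1)`,
  -- and two from the residual at the restart, whose factor is at most 2.
  refine ⟨4 * K, by positivity, fun g xs ρ κ hρ hκ h hs hc => ?_⟩
  have hA := elliptic_opA hρ h hs hc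
  have hres := norm_residual_add_le hκ h hc
  set A := opA g xs with hAdef
  have ha : 0 < Real.sqrt (min μ (μ ^ 2)) := Real.sqrt_pos.2 (lt_min hμ (by positivity))
  have hb : 0 < Real.sqrt (max L (L ^ 2)) := Real.sqrt_pos.2 (lt_max_of_lt_left hL)
  set a := Real.sqrt (min μ (μ ^ 2)) with hadef
  set b := Real.sqrt (max L (L ^ 2)) with hbdef
  have hθ' : 0 < 1 - θ := by linarith
  obtain ⟨R, hR, hR1, hR2⟩ : ∃ R > 0, (κ + 1 / ρ) * R < 1 / K ∧ K * κ * R ≤ (1 - θ) * a := by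
    have hs : 0 < κ + 1 / ρ := by positivity
    refine ⟨min (1 / K / (κ + 1 / ρ) / 2) ((1 - θ) * a / (K * κ)), by positivity, ?_, ?_⟩
    · have h1 := mul_le_mul_of_nonneg_left
        (min_le_left (1 / K / (κ + 1 / ρ) / 2) ((1 - θ) * a / (K * κ))) hs.le
      refine h1.trans_lt ?_
      have : (κ + 1 / ρ) * (1 / K / (κ + 1 / ρ) / 2) = 1 / K / 2 := by field_simp
      rw [this]
      exact half_lt_self (by positivity)
    · have h1 := mul_le_mul_of_nonneg_left
        (min_le_right (1 / K / (κ + 1 / ρ) / 2) ((1 - θ) * a / (K * κ))) (mul_pos hK hκ).le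
      refine h1.trans (le_of_eq ?_)
      field_simp
  -- The constants `a` and `b` compare the energy norms of both types with the Euclidean norm, so
  -- this radius puts `x₀` in the energy ball of radius `a * R`, inside the Euclidean ball of radius
  -- `R`.
  refine ⟨a * R / b, by positivity, fun x₀ hx₀ β hβ => ?_⟩
  have hstart : ∀ ty, normN ty A (x₀ - xs) ≤ a * R := by
    intro ty
    refine (hA.normN_upper ty _).trans ?_
    rw [le_div_iff₀ hb] at hx₀
    linarith
  have hsmall : ∀ ty k, (κ + 1 / ρ) * ‖iterate ty g m τ η β x₀ k - xs‖ < 1 / K := by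
    intro ty k
    have h1 := normN_iterate_le hK (hB ty) hA hμ hβ hκ hρ hres hR1 hR2 (hstart ty) k
      (η := η)
    have h2 := (hA.normN_lower hμ ty _).trans h1
    exact (mul_le_mul_of_nonneg_left (le_of_mul_le_mul_left h2 ha) (by positivity)).trans_lt hR1
  have main := fun ty k => iterate_bounds (η := η) hK (hB ty) hA hβ hκ hρ hres k
    (hsmall ty _)
  have hKκ : ∀ u : Vec d, 0 ≤ K * κ * ‖u‖ ^ 2 := fun u => by positivity
  refine ⟨fun k => ?_, fun k => ?_, fun ty k => ?_⟩
  · intro x mk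
    have h1 : normA A (x (k + 1) - xs) ≤ mixNorm A (β k) * (2 * chebRate μ L ^ mk) *
        normA A (x (k - mk) - xs) + K * κ * ‖x (k - mk) - xs‖ ^ 2 := (main .typeI k).2.1
    have h2 := hKκ (x (k - mk) - xs)
    linarith
  · intro x mk
    obtain ⟨-, h1, -, h2, h3⟩ := main .typeII k
    rw [normN_typeII hA.symm, normN_typeII hA.symm] at h1
    change ‖A (x (k + 1) - xs)‖ ≤ mixNorm A (β k) * (2 * chebRate μ L ^ mk) *
        ‖A (x (k - mk) - xs)‖ + K * κ * ‖x (k - mk) - xs‖ ^ 2 at h1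
    change ‖residual g (x (k - mk)) + A (x (k - mk) - xs)‖ ≤
      K * κ * ‖x (k - mk) - xs‖ ^ 2 at h2
    change ‖residual g (x (k + 1)) + A (x (k + 1) - xs)‖ ≤
      K * κ * ‖x (k - mk) - xs‖ ^ 2 at h3
    have h4 : ‖residual g (x (k + 1))‖ ≤ ‖A (x (k + 1) - xs)‖ +
        K * κ * ‖x (k - mk) - xs‖ ^ 2 := by
      have := norm_sub_norm_le (residual g (x (k + 1))) (-A (x (k + 1) - xs))
      rw [sub_neg_eq_add, norm_neg] at this
      linarith
    have h5 : ‖A (x (k - mk) - xs)‖ ≤ ‖residual g (x (k - mk))‖ +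
        K * κ * ‖x (k - mk) - xs‖ ^ 2 := by
      have := norm_sub_norm_le (-A (x (k - mk) - xs)) (residual g (x (k - mk)))
      rw [norm_neg, ← norm_neg (-A (x (k - mk) - xs) - _)] at this
      have e : -(-A (x (k - mk) - xs) - residual g (x (k - mk))) =
        residual g (x (k - mk)) + A (x (k - mk) - xs) := by abel
      rw [e] at this
      linarith
    have hw0 : 0 ≤ chebRate μ L ^ mk := pow_nonneg (chebRate_nonneg hμ hμL) _
    have hw1 : chebRate μ L ^ mk ≤ 1 := pow_le_one₀ (chebRate_nonneg hμ hμL) chebRate_le_one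
    have hm0 := mixNorm_nonneg A (β k)
    have hfac : mixNorm A (β k) * (2 * chebRate μ L ^ mk) ≤ 2 := by
      have : mixNorm A (β k) * chebRate μ L ^ mk ≤ 1 :=
        mul_le_one₀ ((hβ k).trans hθ₁.le) hw0 hw1
      linarith
    have h6 := mul_le_mul_of_nonneg_left h5 (mul_nonneg hm0 (mul_nonneg zero_le_two hw0))
    have h7 := mul_le_mul_of_nonneg_right hfac (hKκ (x (k - mk) - xs))
    linarith
  · intro x mk hmk
    have h1 : ‖x (k + 1) - xs‖ ≤ K * κ * ‖x (k - mk) - xs‖ ^ 2 := (main ty k).2.2.1 hmk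
    have h2 := hKκ (x (k - mk) - xs)
    linarith
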